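/- Let $d\ge 2$ be an integer, let $p_{\min},p_{\max},r_0,c_{1},c_{2},L_{\min},L_{\max},C,\sigma,r$ be real numbers, all positive, and let $(K_n)$ be a sequence of natural numbers with $K_n\asymp \log^{1+2r} n$. Then there is a sequence of tuning parameters $\lambda_n>0$ (depending only on these data) such that for every $\delta>0$ there are $M>0$ and $n_0$ (depending only on these data and $\delta$) for which the following holds for all $n\ge n_0$. Let $(\mathcal X,d_{\mathcal X})$ be a metric space with its Borel $\sigma$-algebra, $\mu$ a Borel measure on $\mathcal X$, $p$ a probability density with respect to $\mu$, and $f_0:\mathcal X\to\mathbb R$ a measurable function, and suppose that 1. $p_{\min}<p(x)<p_{\max}$ for all $x\in\mathcal X$; 2. $c_1 s^d\le \mu(B_s(x))\le c_2 s^d$ for all $x\in\mathcal X$ and $0<s<r_0$, where $B_s(x)$ is the closed ball; 3. there is a homeomorphism $h:\mathcal X\to[0,1]^d$ with $L_{\min}d_{\mathcal X}(x,x')\le\|h(x)-h(x')\|_2\le L_{\max}d_{\mathcal X}(x,x')$ for all $x,x'\in\mathcal X$. Let $y_i=f_0(x_i)+\varepsilon_i$, $i=1,\dots,n$, where $x_1,\dots,x_n$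 are i.i.d. with density $p$ with respect to $\mu$, and $\varepsilon_1,\dots,\varepsilon_n$ are i.i.d., independent of $(x_1,\dots,x_n)$, with $\mathbb E\,\varepsilon_i=0$ and $\mathbb P(|\varepsilon_i|>t)\le C\exp(-t^2/(2\sigma^2))$ for all $t>0$. Write $K=K_n$ and $\theta^*_i=f_0(x_i)$. For $x\in\mathcal X$ let $\mathcal N_K(x)$ be the set of indices of the $K$ training points closest to $x$ (ties are broken by the smaller index). Let $G_K$ be the graph on $\{1,\dots,n\}$ in which $i\ne j$ are joined if and only if $x_i$ is among the $K$ points of $\{x_l: l\neq j\}$ closest to $x_j$, or vice versa, and let $\|\nabla_{G_K}\theta\|_1=\sum_{\{i,j\}\in E(G_K)}|\theta_i-\theta_j|$. Let $$\hat\theta=\operatorname*{arg\,min}_{\theta\in\mathbb R^n}\Big\{\tfrac12\sum_{i=1}^n(y_i-\theta_i)^2+\lambda_n\|\nabla_{G_K}\theta\|_1\Big\},\qquad \hat f(x)=\frac1{|\mathcal N_K(x)|}\sum_{i\in\mathcal N_K(x)}\hat\theta_i,$$ $$\mathrm{AErr}=\int_{\mathcal X}\Big(f_0(x)-\frac1K\sum_{i\in\mathcal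 N_K(x)}f_0(x_i)\Big)^2p(x)\,\mu(dx)\in[0,\infty].$$ Then, with probability at least $1-\delta$, $$\mathbb E_{X\sim p}|f_0(X)-\hat f(X)|^2\;\le\; M\left(\frac{\log^{1+2r}n}{n}+\frac{\log^{1.5+r}n}{n}\,\|\nabla_{G_K}\theta^*\|_1+\mathrm{AErr}\right),$$ where $X\sim p$ is independent of the sample, so that the left side is $\int_{\mathcal X}(f_0-\hat f)^2\,p\,d\mu$ for the given sample. In particular, for a fixed model, $$\mathbb E_{X\sim p}|f_0(X)-\hat f(X)|^2=O_{\mathbb P}\left(\frac{\log^{1+2r}n}{n}+\frac{\log^{1.5+r}n}{n}\|\nabla_{G_K}\theta^*\|_1+\mathrm{AErr}\right).$$ -/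

import Mathlib

open MeasureTheory ProbabilityTheory Filter Asymptotics
open scoped ENNReal

universe u v

noncomputable section

/-! ### Nearest neighbours -/

/-- `NearerTo z q i j`: the point `z i` comes strictly before `z j` when the points are listed by
increasing distance from `q`, ties being broken by the smaller index. -/
def NearerTo {X : Type u} [MetricSpace X] {n : ℕ} (z : Fin n → X) (q : X) (i j : Fin n) : Prop :=
  dist (z i) q < dist (z j) q ∨ (dist (z i) q = dist (z j) q ∧ i < j)

open Classical in
/-- The indices of the `K` nearest neighbours of `q` among the points `z i`, `i ∈ S`
(all of `S` if `S` has at most `K` elements). -/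
def nearestIn {X : Type u} [MetricSpace X] {n : ℕ} (S : Finset (Fin n)) (z : Fin n → X) (K : ℕ)
    (q : X) : Finset (Fin n) :=
  S.filter fun j => (S.filter fun i => NearerTo z q i j).card < K

/-- `𝒩_K(q)`: the `K` nearest neighbours of `q` in the whole training sample `z`. -/
def nearestNeighbors {X : Type u} [MetricSpace X] {n : ℕ} (z : Fin n → X) (K : ℕ) (q : X) :
    Finset (Fin n) :=
  nearestIn Finset.univ z K q

/-- The (symmetric) `K`-nearest-neighbour graph on the sample: `i ≠ j` are adjacent iff `z i` is
among the `K` observations, other than `z j` itself, that are closest to `z j`, or vice versa. -/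
def knnGraph {X : Type u} [MetricSpace X] {n : ℕ} (z : Fin n → X) (K : ℕ) :
    SimpleGraph (Fin n) :=
  SimpleGraph.fromRel fun i j => i ∈ nearestIn (Finset.univ.erase j) z K (z j)

/-! ### The fused lasso on a graph -/

/-- The edges of `G`, each listed once, oriented from the smaller to the larger index. -/
abbrev OrientedEdge {n : ℕ} (G : SimpleGraph (Fin n)) : Type :=
  {e : Fin n × Fin n // e.1 < e.2 ∧ G.Adj e.1 e.2}

instance {n : ℕ} (G : SimpleGraph (Fin n)) : Fintype (OrientedEdge G) := Fintype.ofFinite _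

/-- The oriented incidence matrix `∇_G`, with one row per edge. -/
def orientedIncidence {n : ℕ} (G : SimpleGraph (Fin n)) : Matrix (OrientedEdge G) (Fin n) ℝ :=
  fun e l => if l = e.1.1 then 1 else if l = e.1.2 then -1 else 0

/-- `‖∇_G θ‖₁`, the total variation of `θ` along `G`. -/
def graphTV {n : ℕ} (G : SimpleGraph (Fin n)) (θ : Fin n → ℝ) : ℝ :=
  ∑ e : OrientedEdge G, |(orientedIncidence G).mulVec θ e|

/-- The fused lasso objective `½ ‖y - θ‖₂² + lam ‖∇_G θ‖₁`. -/
def fusedLassoObjective {n : ℕ} (G : SimpleGraph (Fin n)) (lam : ℝ) (y θ : Fin n → ℝ) : ℝ :=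
  1 / 2 * ∑ i, (y i - θ i) ^ 2 + lam * graphTV G θ

theorem graphTV_nonneg {n : ℕ} (G : SimpleGraph (Fin n)) (θ : Fin n → ℝ) : 0 ≤ graphTV G θ :=
  Finset.sum_nonneg fun _ _ => abs_nonneg _

theorem orientedIncidence_mulVec {n : ℕ} (G : SimpleGraph (Fin n)) (θ : Fin n → ℝ)
    (e : OrientedEdge G) : (orientedIncidence G).mulVec θ e = θ e.1.1 - θ e.1.2 := by
  have hne : e.1.1 ≠ e.1.2 := e.2.1.ne
  have h : ∀ l, orientedIncidence G e l * θ l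
      = (if l = e.1.1 then θ l else 0) - (if l = e.1.2 then θ l else 0) := by
    intro l
    unfold orientedIncidence
    by_cases h1 : l = e.1.1
    · subst h1
      simp [hne]
    · by_cases h2 : l = e.1.2
      · subst h2
        simp [hne.symm]
      · simp [h1, h2]
  simp [Matrix.mulVec, dotProduct, h, Finset.sum_sub_distrib]

/-- The fused lasso problem has exactly one solution. -/
theorem existsUnique_fusedLasso {n : ℕ} (G : SimpleGraph (Fin n)) {lam : ℝ} (hlam : 0 ≤ lam)
    (y : Fin n → ℝ) :
    ∃! θ : Fin n → ℝ, ∀ θ' : Fin n → ℝ,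
      fusedLassoObjective G lam y θ ≤ fusedLassoObjective G lam y θ' := by
  have hcont : Continuous fun θ => fusedLassoObjective G lam y θ := by
    unfold fusedLassoObjective graphTV
    simp only [orientedIncidence_mulVec]
    fun_prop
  obtain ⟨θ, -, hθ⟩ := (isCompact_closedBall y
      (2 * fusedLassoObjective G lam y y + 1)).exists_isMinOn
    (Metric.nonempty_closedBall.2 (by
      have := graphTV_nonneg G y
      simp only [fusedLassoObjective, sub_self]
      norm_num
      positivity)) hcont.continuousOn
  have h0 : 0 ≤ fusedLassoObjective G lam y y := by
    have := graphTV_nonneg G y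
    simp only [fusedLassoObjective, sub_self]
    norm_num
    positivity
  have hglob : ∀ θ' : Fin n → ℝ,
      fusedLassoObjective G lam y θ ≤ fusedLassoObjective G lam y θ' := by
    intro θ'
    by_cases hmem : θ' ∈ Metric.closedBall y (2 * fusedLassoObjective G lam y y + 1)
    · exact hθ hmem
    · refine (hθ (Metric.mem_closedBall_self (by positivity))).trans ?_
      by_contra! hlt
      refine hmem ((dist_pi_le_iff (by positivity)).2 fun i => ?_)
      have h1 : (y i - θ' i) ^ 2 ≤ ∑ i, (y i - θ' i) ^ 2 :=
        Finset.single_le_sum (f := fun i => (y i - θ' i) ^ 2) (fun _ _ => sq_nonneg _)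
          (Finset.mem_univ i)
      have h2 : 0 ≤ lam * graphTV G θ' := mul_nonneg hlam (graphTV_nonneg G θ')
      have h3 : (y i - θ' i) ^ 2 ≤ 2 * fusedLassoObjective G lam y y := by
        change fusedLassoObjective G lam y θ' < _ at hlt
        have : fusedLassoObjective G lam y θ'
            = 1 / 2 * ∑ i, (y i - θ' i) ^ 2 + lam * graphTV G θ' := rfl
        linarith
      rw [Real.dist_eq, abs_le]
      constructor <;> nlinarith
  refine ⟨θ, hglob, fun η hη => ?_⟩
  have hmid : graphTV G (fun i => (θ i + η i) / 2) ≤ (graphTV G θ + graphTV G η) / 2 := by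
    unfold graphTV
    simp only [orientedIncidence_mulVec]
    rw [← Finset.sum_add_distrib, Finset.sum_div]
    refine Finset.sum_le_sum fun e _ => ?_
    have hhalf : (θ e.1.1 + η e.1.1) / 2 - (θ e.1.2 + η e.1.2) / 2
        = ((θ e.1.1 - θ e.1.2) + (η e.1.1 - η e.1.2)) / 2 := by ring
    rw [hhalf, abs_div, abs_of_pos (two_pos : (0 : ℝ) < 2)]
    have := abs_add_le (θ e.1.1 - θ e.1.2) (η e.1.1 - η e.1.2)
    linarith
  have hsq : ∑ i, (y i - (θ i + η i) / 2) ^ 2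
      = (∑ i, (y i - θ i) ^ 2 + ∑ i, (y i - η i) ^ 2) / 2 - 1 / 4 * ∑ i, (θ i - η i) ^ 2 := by
    rw [← Finset.sum_add_distrib, Finset.sum_div, Finset.mul_sum, ← Finset.sum_sub_distrib]
    exact Finset.sum_congr rfl fun i _ => by ring
  have e1 := hglob (fun i => (θ i + η i) / 2)
  have e2 := hη (fun i => (θ i + η i) / 2)
  have hmid' := mul_le_mul_of_nonneg_left hmid hlam
  unfold fusedLassoObjective at e1 e2
  rw [hsq] at e1 e2
  have hz : ∑ i, (θ i - η i) ^ 2 ≤ 0 := by linarith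
  funext i
  have h1 : (θ i - η i) ^ 2 ≤ ∑ i, (θ i - η i) ^ 2 :=
    Finset.single_le_sum (f := fun i => (θ i - η i) ^ 2) (fun _ _ => sq_nonneg _)
      (Finset.mem_univ i)
  have h2 : θ i - η i = 0 := pow_eq_zero_iff two_ne_zero |>.1
    (le_antisymm (h1.trans hz) (sq_nonneg _))
  linarith

/-- The fused lasso estimator: the minimiser of the objective (it exists and is unique whenever
`0 ≤ lam`; the value for `lam < 0` is irrelevant). -/
def fusedLasso {n : ℕ} (G : SimpleGraph (Fin n)) (lam : ℝ) (y : Fin n → ℝ) : Fin n → ℝ :=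
  Classical.epsilon fun θ => ∀ θ' : Fin n → ℝ,
    fusedLassoObjective G lam y θ ≤ fusedLassoObjective G lam y θ'

theorem fusedLasso_spec {n : ℕ} (G : SimpleGraph (Fin n)) {lam : ℝ} (hlam : 0 ≤ lam)
    (y θ' : Fin n → ℝ) :
    fusedLassoObjective G lam y (fusedLasso G lam y) ≤ fusedLassoObjective G lam y θ' :=
  Classical.epsilon_spec (p := fun θ => ∀ θ' : Fin n → ℝ,
    fusedLassoObjective G lam y θ ≤ fusedLassoObjective G lam y θ')
    (existsUnique_fusedLasso G hlam y).exists θ'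

/-! ### The `K`-NN fused lasso and its prediction rule -/

/-- The `K`-NN fused lasso estimator `θ̂` from design points `z` and responses `y`. -/
def knnFusedLasso {X : Type u} [MetricSpace X] {n : ℕ} (z : Fin n → X) (K : ℕ) (lam : ℝ)
    (y : Fin n → ℝ) : Fin n → ℝ :=
  fusedLasso (knnGraph z K) lam y

/-- The prediction rule: the average of `θ` over the `K` nearest training points of `q`. -/
def knnPredict {X : Type u} [MetricSpace X] {n : ℕ} (z : Fin n → X) (K : ℕ) (θ : Fin n → ℝ)
    (q : X) : ℝ :=
  ((nearestNeighbors z K q).card : ℝ)⁻¹ * ∑ i ∈ nearestNeighbors z K q, θ i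

/-- The law on `X` with density `p` with respect to `μ`. -/
def densityLaw {X : Type u} [MeasurableSpace X] (μ : Measure X) (p : X → ℝ) : Measure X :=
  μ.withDensity fun q => ENNReal.ofReal (p q)

/-- The integrated squared error `E_{X ∼ ν} |f₀(X) - f(X)|²`, with values in `[0, ∞]`. -/
def integratedSqError {X : Type u} [MeasurableSpace X] (ν : Measure X) (f₀ f : X → ℝ) : ℝ≥0∞ :=
  ∫⁻ q, ENNReal.ofReal ((f₀ q - f q) ^ 2) ∂ν

/-- The approximation error `AErr`: the integrated squared error of the `K`-NN average of the
true values `f₀ (z i)`. -/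
def approxError {X : Type u} [MetricSpace X] [MeasurableSpace X] (ν : Measure X) (f₀ : X → ℝ)
    {n : ℕ} (z : Fin n → X) (K : ℕ) : ℝ≥0∞ :=
  integratedSqError ν f₀ fun q => 1 / (K : ℝ) * ∑ i ∈ nearestNeighbors z K q, f₀ (z i)

/-! ### The model -/

/-- The cube `[0,1]^d` with the Euclidean metric. -/
def unitCube (d : ℕ) : Set (EuclideanSpace ℝ (Fin d)) := {w | ∀ i, w i ∈ Set.Icc (0 : ℝ) 1}

/-- `p` is a probability density with respect to `μ` lying strictly between `pmin` and `pmax`. -/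
structure IsBoundedDensity {X : Type u} [MeasurableSpace X] (μ : Measure X) (p : X → ℝ)
    (pmin pmax : ℝ) : Prop where
  measurable : Measurable p
  lintegral_eq_one : ∫⁻ q, ENNReal.ofReal (p q) ∂μ = 1
  lower : ∀ q, pmin < p q
  upper : ∀ q, p q < pmax

/-- Balls of radius `r < r₀` have `μ`-volume between `c₁ r ^ d` and `c₂ r ^ d`. -/
def HasBallVolume {X : Type u} [MetricSpace X] [MeasurableSpace X] (μ : Measure X) (d : ℕ)
    (r₀ c₁ c₂ : ℝ) : Prop :=
  ∀ (q : X) (r : ℝ), 0 < r → r < r₀ →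
    ENNReal.ofReal (c₁ * r ^ d) ≤ μ (Metric.closedBall q r) ∧
      μ (Metric.closedBall q r) ≤ ENNReal.ofReal (c₂ * r ^ d)

/-- `X` is homeomorphic to `[0,1]^d` through a map that distorts distances by a factor between
`Lmin` and `Lmax`. -/
def IsBilipschitzCube (X : Type u) [MetricSpace X] (d : ℕ) (Lmin Lmax : ℝ) : Prop :=
  ∃ h : X ≃ₜ unitCube d, ∀ q q' : X,
    Lmin * dist q q' ≤ ‖(h q : EuclideanSpace ℝ (Fin d)) - h q'‖ ∧
      ‖(h q : EuclideanSpace ℝ (Fin d)) - h q'‖ ≤ Lmax * dist q q'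

/-- `x` is an i.i.d. sample from the law `ν`, and the errors `ε` are i.i.d., centred, sub-Gaussian
with constants `C` and `σ`, and independent of `x`. -/
structure IsRegressionSample {X : Type u} [MeasurableSpace X] {Ω : Type v} [MeasurableSpace Ω]
    (P : Measure Ω) (ν : Measure X) (C σ : ℝ) {n : ℕ} (x : Fin n → Ω → X) (ε : Fin n → Ω → ℝ) :
    Prop where
  measurable_x : ∀ i, Measurable (x i)
  law_x : ∀ i, P.map (x i) = ν
  indep_x : iIndepFun x P
  measurable_noise : ∀ i, Measurable (ε i)
  indep_noise : iIndepFun ε P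
  ident_noise : ∀ i j, IdentDistrib (ε i) (ε j) P P
  mean_noise : ∀ i, ∫ ω, ε i ω ∂P = 0
  tail_noise : ∀ i, ∀ t : ℝ, 0 < t →
    P {ω | t < |ε i ω|} ≤ ENNReal.ofReal (C * Real.exp (-t ^ 2 / (2 * σ ^ 2)))
  indep_x_noise : IndepFun (fun ω i => x i ω) (fun ω i => ε i ω) P

end

/-!
The rate follows from one inequality for the noise: with high probability, for all `v`,
`|∑ i, ε i * v i| ≤ A ‖v‖₂ + B ‖∇_G v‖₁`, where `G` is the `K`-nearest-neighbour graph,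
`A ^ 2` is of order `log ^ (1 + 2 r) n` and `B` of order `log ^ (3 / 2 + r) n`. Comparing the
objective at the estimator and at the truth then bounds the estimation error at the sample points
by `4 A ^ 2 + 8 lam ‖∇_G θ‖₁` as soon as `lam ≥ B` (`fusedLasso_sq_error_le`).

To prove the inequality, pull the dyadic cubes of side `2 ^ (-J)` of `[0,1] ^ d` back to `X`, with
`2 ^ (J d)` a large multiple of `n / K`. By Chernoff bounds and `K ≫ log n`, every cell contains a
sample point, and the ball of radius comparable to its diameter around it contains fewer than `K`
of them, so that sample points in the same or in neighbouring cells are adjacent in `G`. Replacing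
`v` by its values at one representative per cell costs `max |ε i| ‖∇_G v‖₁`, and leaves a function
`u` on a grid whose total variation is controlled by that of `v` (`abs_sum_noise_mul_le`).

The grid function is written as `u c - mean u = ∑ e, G c e * (∇ u) e`. Telescoping the averages of
`u` over the dyadic cubes that contain `c`, and writing the difference of two neighbouring averages
through segments of edges, yields a kernel of size `2 ^ j / 2 ^ (j d)` at scale `2 ^ j`, whose
columns have squared norm `O(J) = O(log n)` because `d ≥ 2` (`exists_gridKernel`). Conditionally on
the cells of the design points, the correlations of the noise with these columns are sub-Gaussian
with variance `O(K log n)`, whence `B` is of order `√K log n` by a union bound over the edges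
(`measure_exists_edge_noise_ge_le`). The mean of `u` is at most `‖v‖₂ 2 ^ (-J d / 2)`, and
`∑ i, ε i` is of order `√n`, which gives `A`.

The prediction error at a new point is at most twice its approximation error plus twice the average
squared estimation error over its nearest neighbours (`integratedSqError_knnPredict_le`). A second,
coarser grid, whose cells all hold at least `K` sample points, shows that the set of points having
a given `i` among their neighbours lies in a ball of mass `O(K / n)`.
-/


noncomputable section

/-! ### Total variation along a graph and the basic inequality -/

theorem graphTV_eq_sum {n : ℕ} (G : SimpleGraph (Fin n)) (θ : Fin n → ℝ) :
    graphTV G θ = ∑ e : OrientedEdge G, |θ e.1.1 - θ e.1.2| := by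
  simp only [graphTV, orientedIncidence_mulVec]

open Classical in
/-- Every edge is counted twice among the ordered pairs of adjacent vertices. -/
theorem sum_adj_abs_sub {n : ℕ} (G : SimpleGraph (Fin n)) (θ : Fin n → ℝ) :
    ∑ p ∈ (Finset.univ : Finset (Fin n × Fin n)).filter (fun p => G.Adj p.1 p.2),
      |θ p.1 - θ p.2| = 2 * graphTV G θ := by
  have h1 : graphTV G θ = ∑ p ∈ (Finset.univ : Finset (Fin n × Fin n)).filter
      (fun p => p.1 < p.2 ∧ G.Adj p.1 p.2), |θ p.1 - θ p.2| := by
    rw [graphTV_eq_sum]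
    exact (Finset.sum_subtype _ (by simp) fun p : Fin n × Fin n => |θ p.1 - θ p.2|).symm
  have h2 : graphTV G θ = ∑ p ∈ (Finset.univ : Finset (Fin n × Fin n)).filter
      (fun p => p.2 < p.1 ∧ G.Adj p.1 p.2), |θ p.1 - θ p.2| := by
    rw [h1]
    refine Finset.sum_equiv (Equiv.prodComm _ _) (fun p => ?_) (fun p _ => ?_)
    · simp [G.adj_comm]
    · simp [abs_sub_comm]
  rw [two_mul]
  nth_rewrite 1 [h1]
  rw [h2, ← Finset.sum_union]
  · refine Finset.sum_congr ?_ fun _ _ => rfl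
    ext p
    simp only [Finset.mem_filter, Finset.mem_univ, true_and, Finset.mem_union, ← or_and_right]
    exact ⟨fun h => ⟨h.ne.lt_or_gt, h⟩, fun h => h.2⟩
  · rw [Finset.disjoint_filter]
    rintro p - h h'
    exact lt_asymm h.1 h'.1

/-- A family of distinct ordered pairs, each degenerate or adjacent, has at most twice the total
variation along the graph. -/
theorem sum_abs_sub_le_graphTV {n : ℕ} {ι : Type*} (G : SimpleGraph (Fin n)) (θ : Fin n → ℝ)
    (s : Finset ι) (a b : ι → Fin n) (hinj : Set.InjOn (fun e => (a e, b e)) s)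
    (hadj : ∀ e ∈ s, a e ≠ b e → G.Adj (a e) (b e)) :
    ∑ e ∈ s, |θ (a e) - θ (b e)| ≤ 2 * graphTV G θ := by
  classical
  rw [← sum_adj_abs_sub, ← Finset.sum_filter_add_sum_filter_not s (fun e => a e ≠ b e)]
  have h0 : ∑ e ∈ s.filter (fun e => ¬ a e ≠ b e), |θ (a e) - θ (b e)| = 0 :=
    Finset.sum_eq_zero fun e he => by
      have := (Finset.mem_filter.1 he).2
      rw [not_not.1 this]
      simp
  rw [h0, add_zero, ← Finset.sum_image (f := fun p : Fin n × Fin n => |θ p.1 - θ p.2|)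
    (g := fun e => (a e, b e)) (hinj.mono (by simp [Set.subset_def]; tauto))]
  refine Finset.sum_le_sum_of_subset_of_nonneg (fun p hp => ?_) fun _ _ _ => abs_nonneg _
  obtain ⟨e, he, rfl⟩ := Finset.mem_image.1 hp
  obtain ⟨he, hne⟩ := Finset.mem_filter.1 he
  exact Finset.mem_filter.2 ⟨Finset.mem_univ _, hadj e he hne⟩

theorem graphTV_sub_le {n : ℕ} (G : SimpleGraph (Fin n)) (θ η : Fin n → ℝ) :
    graphTV G (θ - η) ≤ graphTV G θ + graphTV G η := by
  simp only [graphTV_eq_sum, ← Finset.sum_add_distrib]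
  refine Finset.sum_le_sum fun e _ => ?_
  have h : (θ - η) e.1.1 - (θ - η) e.1.2 = (θ e.1.1 - θ e.1.2) - (η e.1.1 - η e.1.2) := by
    simp only [Pi.sub_apply]; ring
  rw [h]
  exact abs_sub _ _

/-- If the noise, as a functional, is dominated by `A ‖·‖₂ + lam ‖∇_G ·‖₁`, then the fused lasso
with penalty `lam` estimates `θ` at the rate `A ^ 2 + lam ‖∇_G θ‖₁`. -/
theorem fusedLasso_sq_error_le {n : ℕ} (G : SimpleGraph (Fin n)) {lam A : ℝ} (hlam : 0 ≤ lam)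
    (θ ε : Fin n → ℝ)
    (hε : ∀ v : Fin n → ℝ,
      |∑ i, ε i * v i| ≤ A * Real.sqrt (∑ i, v i ^ 2) + lam * graphTV G v) :
    ∑ i, (θ i - fusedLasso G lam (fun i => θ i + ε i) i) ^ 2
      ≤ 4 * A ^ 2 + 8 * lam * graphTV G θ := by
  set η := fusedLasso G lam (fun i => θ i + ε i) with hη
  have hmin := fusedLasso_spec G hlam (fun i => θ i + ε i) θ
  rw [← hη] at hmin
  simp only [fusedLassoObjective] at hmin
  have hexp : ∑ i, (θ i + ε i - η i) ^ 2
      = ∑ i, (θ i + ε i - θ i) ^ 2 - 2 * ∑ i, ε i * (η - θ) i + ∑ i, (θ i - η i) ^ 2 := by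
    rw [Finset.mul_sum, ← Finset.sum_sub_distrib, ← Finset.sum_add_distrib]
    refine Finset.sum_congr rfl fun i _ => ?_
    simp only [Pi.sub_apply]
    ring
  have h1 := (le_abs_self _).trans (hε (η - θ))
  have h2 := mul_le_mul_of_nonneg_left (graphTV_sub_le G η θ) hlam
  have h3 : ∑ i, (η - θ) i ^ 2 = ∑ i, (θ i - η i) ^ 2 :=
    Finset.sum_congr rfl fun i _ => by simp only [Pi.sub_apply]; ring
  set D := ∑ i, (θ i - η i) ^ 2 with hD
  rw [h3] at h1
  have h4 : Real.sqrt D ^ 2 = D := Real.sq_sqrt (Finset.sum_nonneg fun i _ => sq_nonneg _)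
  nlinarith [sq_nonneg (Real.sqrt D - 2 * A)]

/-! ### Representing deviations from the mean on a dyadic grid -/

/-- The cells of the dyadic grid of side `2 ^ J` in dimension `d`, as integer vectors. -/
def gridCells (d J : ℕ) : Finset (Fin d → ℕ) :=
  Fintype.piFinset fun _ => Finset.range (2 ^ J)

/-- The edges of the dyadic grid: `(z, l)` stands for the edge from `z` to `z + e_l`. -/
def gridEdges (d J : ℕ) : Finset ((Fin d → ℕ) × Fin d) :=
  (gridCells d J ×ˢ Finset.univ).filter fun e => e.1 e.2 + 1 < 2 ^ J

/-- The increment of `u` along the edge from `z` to `z + e_l`. -/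
def gridDiff {d : ℕ} (u : (Fin d → ℕ) → ℝ) (e : (Fin d → ℕ) × Fin d) : ℝ :=
  u (e.1 + Pi.single e.2 1) - u e.1

/-- The average of `u` over the box with lower corner `a` and side lengths `s`. -/
def boxAverage {d : ℕ} (a s : Fin d → ℕ) (u : (Fin d → ℕ) → ℝ) : ℝ :=
  (∏ l, (s l : ℝ))⁻¹ * ∑ t ∈ Fintype.piFinset fun l => Finset.range (s l), u (a + t)

/-- The lower corner of the box that contains `c` in the partition of `ℕ ^ d` into boxes of side
lengths `s`. -/
def boxCorner {d : ℕ} (s c : Fin d → ℕ) : Fin d → ℕ := fun l => s l * (c l / s l)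

theorem mem_gridCells {d J : ℕ} {c : Fin d → ℕ} : c ∈ gridCells d J ↔ ∀ l, c l < 2 ^ J := by
  simp [gridCells]

theorem mem_gridEdges {d J : ℕ} {e : (Fin d → ℕ) × Fin d} :
    e ∈ gridEdges d J ↔ (∀ l, e.1 l < 2 ^ J) ∧ e.1 e.2 + 1 < 2 ^ J := by
  simp [gridEdges, mem_gridCells]

theorem card_gridCells (d J : ℕ) : (gridCells d J).card = 2 ^ (J * d) := by
  simp [gridCells, pow_mul]

theorem card_gridEdges_le (d J : ℕ) : (gridEdges d J).card ≤ d * 2 ^ (J * d) := by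
  refine (Finset.card_filter_le _ _).trans ?_
  simp [Finset.card_product, card_gridCells, mul_comm]

/-- Telescoping along a segment in direction `l`. -/
theorem segment_sum_gridDiff {d : ℕ} (u : (Fin d → ℕ) → ℝ) (a : Fin d → ℕ) (l : Fin d) (m : ℕ) :
    ∑ i ∈ Finset.range m, gridDiff u (a + Pi.single l i, l) = u (a + Pi.single l m) - u a := by
  induction m with
  | zero => simp
  | succ m ih =>
    rw [Finset.sum_range_succ, ih]
    simp only [gridDiff, add_assoc, ← Pi.single_add]
    ring

/-- The average over a box of the increment `u (x + m e_l) - u x`, where `m` is the side length of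
the box in direction `l`, is a combination of grid increments in direction `l` over the doubled
box. A given edge serves at most `m` of the `∏ s` segments. -/
theorem boxAverage_shift_sub {d J : ℕ} (a s : Fin d → ℕ) (l : Fin d)
    (hJ : ∀ l', a l' + Function.update s l (2 * s l) l' ≤ 2 ^ J) :
    ∃ g : (Fin d → ℕ) × Fin d → ℝ,
      (∀ u, boxAverage (a + Pi.single l (s l)) s u - boxAverage a s u
        = ∑ e ∈ gridEdges d J, g e * gridDiff u e) ∧
      (∀ e, |g e| ≤ (∏ l', (s l' : ℝ))⁻¹ * s l) ∧
      ∀ e, g e ≠ 0 → e.2 = l ∧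
        ∀ l', a l' ≤ e.1 l' ∧ e.1 l' < a l' + Function.update s l (2 * s l) l' := by
  classical
  set T : Finset (Fin d → ℕ) := Fintype.piFinset fun l => Finset.range (s l) with hT
  set E : (Fin d → ℕ) × ℕ → (Fin d → ℕ) × Fin d :=
    fun p => (a + p.1 + Pi.single l p.2, l) with hE
  set S := T ×ˢ Finset.range (s l) with hS
  have hbox : ∀ p ∈ S, ∀ l', a l' ≤ (E p).1 l' ∧
      (E p).1 l' < a l' + Function.update s l (2 * s l) l' := by
    rintro ⟨t, i⟩ hp l'
    simp only [hS, hT, Finset.mem_product, Fintype.mem_piFinset, Finset.mem_range] at hp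
    have h1 := hp.1 l'
    have h2 := hp.2
    by_cases h : l' = l
    · subst h
      simp only [hE, Pi.add_apply, Pi.single_eq_same, Function.update_self]
      omega
    · simp only [hE, Pi.add_apply, Pi.single_eq_of_ne h, Function.update_of_ne h]
      omega
  have hedge : ∀ p ∈ S, E p ∈ gridEdges d J := by
    rintro ⟨t, i⟩ hp
    have hb := hbox _ hp
    refine mem_gridEdges.2 ⟨fun l' => (hb l').2.trans_le (hJ l'), ?_⟩
    simp only [hS, hT, Finset.mem_product, Fintype.mem_piFinset, Finset.mem_range] at hp
    have h1 := hp.1 l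
    have h3 := hJ l
    simp only [Function.update_self] at h3
    simp only [hE, Pi.add_apply, Pi.single_eq_same]
    omega
  refine ⟨fun e => (∏ l', (s l' : ℝ))⁻¹ * (S.filter fun p => E p = e).card, fun u => ?_,
    fun e => ?_, fun e he => ?_⟩
  · have h1 : boxAverage (a + Pi.single l (s l)) s u - boxAverage a s u
        = (∏ l', (s l' : ℝ))⁻¹ * ∑ p ∈ S, gridDiff u (E p) := by
      rw [hS, Finset.sum_product]
      simp only [hE, segment_sum_gridDiff, boxAverage, ← mul_sub, ← Finset.sum_sub_distrib]
      congr 1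
      refine Finset.sum_congr rfl fun t _ => ?_
      rw [add_right_comm]
    rw [h1, ← Finset.sum_fiberwise_of_maps_to hedge, Finset.mul_sum]
    refine Finset.sum_congr rfl fun e _ => ?_
    rw [Finset.sum_congr rfl (g := fun _ => gridDiff u e)
      (fun p hp => by rw [(Finset.mem_filter.1 hp).2])]
    rw [Finset.sum_const, nsmul_eq_mul, mul_assoc]
  · rw [abs_of_nonneg (by positivity)]
    refine mul_le_mul_of_nonneg_left (Nat.cast_le.2 ?_) (by positivity)
    refine (Finset.card_le_card_of_injOn Prod.snd (t := Finset.range (s l)) ?_ ?_).trans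
      (by simp)
    · intro p hp
      have := (Finset.mem_filter.1 hp).1
      exact Finset.mem_coe.2 (Finset.mem_product.1 this).2
    · rintro ⟨t, i⟩ hp ⟨t', i'⟩ hp' (rfl : i = i')
      have h1 := (Finset.mem_filter.1 hp).2
      have h2 := (Finset.mem_filter.1 hp').2
      have h3 := congrArg Prod.fst (h1.trans h2.symm)
      simp only [hE, add_left_inj, add_right_inj] at h3
      rw [h3]
  · have hne : (S.filter fun p => E p = e).Nonempty := by
      rw [Finset.nonempty_iff_ne_empty]
      intro h0
      simp [h0] at he
    obtain ⟨p, hp⟩ := hne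
    obtain ⟨hpS, rfl⟩ := Finset.mem_filter.1 hp
    exact ⟨rfl, hbox p hpS⟩

/-- Doubling a box in one direction averages it with its neighbour. -/
theorem boxAverage_double {d : ℕ} (a s : Fin d → ℕ) (l : Fin d) (u : (Fin d → ℕ) → ℝ) :
    boxAverage a (Function.update s l (2 * s l)) u
      = (boxAverage a s u + boxAverage (a + Pi.single l (s l)) s u) / 2 := by
  classical
  have hprod : (∏ l', ((Function.update s l (2 * s l) l' : ℕ) : ℝ)) = 2 * ∏ l', (s l' : ℝ) := by
    have : (∏ l', Function.update s l (2 * s l) l') = 2 * ∏ l', s l' := by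
      rw [Finset.prod_update_of_mem (Finset.mem_univ l), mul_assoc,
        ← Finset.mul_prod_erase Finset.univ s (Finset.mem_univ l), Finset.sdiff_singleton_eq_erase]
    exact_mod_cast this
  have hsum : ∑ t ∈ Fintype.piFinset fun l' => Finset.range (Function.update s l (2 * s l) l'),
      u (a + t) = (∑ t ∈ Fintype.piFinset fun l => Finset.range (s l), u (a + t))
        + ∑ t ∈ Fintype.piFinset fun l => Finset.range (s l), u (a + Pi.single l (s l) + t) := by
    rw [← Finset.sum_filter_add_sum_filter_not _ (fun t : Fin d → ℕ => t l < s l)]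
    congr 1
    · refine Finset.sum_congr ?_ fun _ _ => rfl
      ext t
      simp only [Finset.mem_filter, Fintype.mem_piFinset, Finset.mem_range]
      constructor
      · rintro ⟨h1, h2⟩ l'
        by_cases h : l' = l
        · subst h; exact h2
        · have := h1 l'
          rwa [Function.update_of_ne h] at this
      · intro h1
        refine ⟨fun l' => ?_, h1 l⟩
        by_cases h : l' = l
        · subst h
          have := h1 l'
          simp only [Function.update_self]
          omega
        · rw [Function.update_of_ne h]
          exact h1 l'
    · symm
      refine Finset.sum_bij (fun t _ => Pi.single l (s l) + t) ?_ ?_ ?_ ?_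
      · intro t ht
        simp only [Finset.mem_filter, Fintype.mem_piFinset, Finset.mem_range] at ht ⊢
        refine ⟨fun l' => ?_, by simp⟩
        have := ht l'
        by_cases h : l' = l
        · subst h
          simp only [Function.update_self, Pi.add_apply, Pi.single_eq_same]
          omega
        · simpa [Function.update_of_ne h, Pi.single_eq_of_ne h] using this
      · intro t _ t' _ h
        exact add_left_cancel h
      · intro t ht
        simp only [Finset.mem_filter, Fintype.mem_piFinset, Finset.mem_range, not_lt] at ht
        refine ⟨fun l' => t l' - (Pi.single l (s l) : Fin d → ℕ) l', ?_, ?_⟩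
        · simp only [Fintype.mem_piFinset, Finset.mem_range]
          intro l'
          have := ht.1 l'
          by_cases h : l' = l
          · subst h
            simp only [Function.update_self, Pi.single_eq_same] at this ⊢
            have := ht.2
            omega
          · simpa [Function.update_of_ne h, Pi.single_eq_of_ne h] using this
        · ext l'
          by_cases h : l' = l
          · subst h
            have := ht.2
            simp only [Pi.add_apply, Pi.single_eq_same]
            omega
          · simp [Pi.single_eq_of_ne h]
      · intro t _
        rw [add_assoc]
  simp only [boxAverage, hprod, hsum]
  rw [mul_inv]
  ring

/-- One doubling step of the chain of boxes around `c`, written through grid increments. -/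
theorem boxAverage_sub_double {d J : ℕ} (s c : Fin d → ℕ) (l : Fin d) (hs : ∀ l', 0 < s l')
    (hdvd : ∀ l', Function.update s l (2 * s l) l' ∣ 2 ^ J) (hc : c ∈ gridCells d J) :
    ∃ g : (Fin d → ℕ) × Fin d → ℝ,
      (∀ u, boxAverage (boxCorner s c) s u
          - boxAverage (boxCorner (Function.update s l (2 * s l)) c)
              (Function.update s l (2 * s l)) u
        = ∑ e ∈ gridEdges d J, g e * gridDiff u e) ∧
      (∀ e, |g e| ≤ (∏ l', (s l' : ℝ))⁻¹ * s l) ∧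
      ∀ e, g e ≠ 0 → e.2 = l ∧ ∀ l', e.1 l' / Function.update s l (2 * s l) l'
        = c l' / Function.update s l (2 * s l) l' := by
  classical
  set s' := Function.update s l (2 * s l) with hs'
  have hs'pos : ∀ l', 0 < s' l' := fun l' => by
    by_cases h : l' = l
    · subst h; simp [hs', hs]
    · simp [hs', h, hs]
  set a := boxCorner s' c with ha
  obtain ⟨g, hg, hb, hz⟩ := boxAverage_shift_sub (J := J) a s l (fun l' => by
    obtain ⟨m, hm⟩ := hdvd l'
    have h1 := mem_gridCells.1 hc l'
    have h2 : c l' / s' l' < m := Nat.div_lt_of_lt_mul (hm ▸ h1)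
    calc a l' + s' l' = s' l' * (c l' / s' l' + 1) := by rw [ha, boxCorner]; ring
      _ ≤ s' l' * m := Nat.mul_le_mul_left _ h2
      _ = 2 ^ J := hm.symm)
  have hdiv : ∀ e, g e ≠ 0 → e.2 = l ∧ ∀ l', e.1 l' / s' l' = c l' / s' l' := by
    intro e he
    obtain ⟨h1, h2⟩ := hz e he
    refine ⟨h1, fun l' => ?_⟩
    have h3 := h2 l'
    rw [Nat.div_eq_iff (hs'pos l')]
    simp only [ha, boxCorner] at h3
    rw [mul_comm]
    have := hs'pos l'
    constructor
    · exact h3.1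
    · have h4 : e.1 l' < s' l' * (c l' / s' l') + s' l' := h3.2
      omega
  have hcorner : boxCorner s c = a ∨ boxCorner s c = a + Pi.single l (s l) := by
    have hother : ∀ l', l' ≠ l → boxCorner s c l' = a l' := fun l' h => by
      simp [ha, boxCorner, hs', h]
    have hl : a l = s l * (2 * (c l / s l / 2)) := by
      simp only [ha, boxCorner, hs', Function.update_self]
      rw [mul_comm 2 (s l), ← Nat.div_div_eq_div_mul]
      ring
    rcases Nat.mod_two_eq_zero_or_one (c l / s l) with h | h
    · left
      ext l'
      by_cases h' : l' = l
      · subst h'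
        rw [hl, boxCorner]
        congr 1
        omega
      · exact hother l' h'
    · right
      ext l'
      by_cases h' : l' = l
      · subst h'
        rw [Pi.add_apply, hl, boxCorner, Pi.single_eq_same, ← Nat.mul_succ]
        congr 1
        omega
      · simp [Pi.single_eq_of_ne h', hother l' h']
  have hhalf : ∀ e, |g e / 2| ≤ (∏ l', (s l' : ℝ))⁻¹ * s l := fun e => by
    rw [abs_div, abs_two]
    linarith [hb e, abs_nonneg (g e)]
  rcases hcorner with h | h
  · refine ⟨fun e => -(g e / 2), fun u => ?_, fun e => ?_, fun e he => hdiv e ?_⟩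
    · simp only [neg_mul, Finset.sum_neg_distrib, div_mul_eq_mul_div, ← Finset.sum_div, ← hg u]
      rw [boxAverage_double, h]
      ring
    · rw [abs_neg]
      exact hhalf e
    · intro h0
      simp [h0] at he
  · refine ⟨fun e => g e / 2, fun u => ?_, hhalf, fun e he => hdiv e ?_⟩
    · simp only [div_mul_eq_mul_div, ← Finset.sum_div, ← hg u]
      rw [boxAverage_double, h]
      ring
    · intro h0
      simp [h0] at he

/-- Passing from the dyadic cube of side `2 ^ j` around `c` to the one of side `2 ^ (j + 1)`. -/
theorem boxAverage_sub_boxAverage_succ {d J j : ℕ} (hj : j < J) (c : Fin d → ℕ)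
    (hc : c ∈ gridCells d J) :
    ∃ g : (Fin d → ℕ) × Fin d → ℝ,
      (∀ u, boxAverage (boxCorner (fun _ => 2 ^ j) c) (fun _ => 2 ^ j) u
          - boxAverage (boxCorner (fun _ => 2 ^ (j + 1)) c) (fun _ => 2 ^ (j + 1)) u
        = ∑ e ∈ gridEdges d J, g e * gridDiff u e) ∧
      (∀ e, |g e| ≤ ((2 : ℝ) ^ (j * d))⁻¹ * 2 ^ j) ∧
      ∀ e, g e ≠ 0 → ∀ l, e.1 l / 2 ^ (j + 1) = c l / 2 ^ (j + 1) := by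
  classical
  -- `S m` is the side vector after the first `m` directions have been doubled.
  set S : ℕ → Fin d → ℕ := fun m l => if (l : ℕ) < m then 2 ^ (j + 1) else 2 ^ j with hS
  have hSpos : ∀ m l, 0 < S m l := fun m l => by
    simp only [hS]; split_ifs <;> positivity
  have hSdvd : ∀ m l, S m l ∣ 2 ^ (j + 1) := fun m l => by
    simp only [hS]; split_ifs
    · rfl
    · exact pow_dvd_pow 2 (Nat.le_succ j)
  have hSsucc : ∀ l : Fin d, S (l + 1) = Function.update (S l) l (2 * S l l) := fun l => by
    ext l'
    by_cases h : l' = l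
    · subst h
      simp [hS, pow_succ, mul_comm]
    · have h' : (l' : ℕ) ≠ l := fun h'' => h (Fin.ext h'')
      have : ((l' : ℕ) < l + 1) ↔ (l' : ℕ) < l := by omega
      simp [hS, h, this]
  have hstep := fun l : Fin d => boxAverage_sub_double (J := J) (S l) c l (hSpos l)
    (fun l' => by
      rw [← hSsucc l]
      exact (hSdvd _ _).trans (pow_dvd_pow 2 hj)) hc
  simp only [← hSsucc] at hstep
  choose g hg hb hz using hstep
  refine ⟨fun e => g e.2 e, fun u => ?_, fun e => (hb e.2 e).trans ?_, fun e he l => ?_⟩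
  · have h0 : (fun _ : Fin d => 2 ^ j) = S 0 := by ext; simp [hS]
    have h1 : (fun _ : Fin d => 2 ^ (j + 1)) = S d := by ext l; simp [hS, l.2]
    rw [h0, h1, ← neg_sub,
      ← Finset.sum_range_sub (fun m => boxAverage (boxCorner (S m) c) (S m) u) d,
      ← Fin.sum_univ_eq_sum_range
        (fun m => boxAverage (boxCorner (S (m + 1)) c) (S (m + 1)) u
          - boxAverage (boxCorner (S m) c) (S m) u), ← Finset.sum_neg_distrib]
    simp only [neg_sub, hg]
    rw [Finset.sum_comm]
    refine Finset.sum_congr rfl fun e _ => ?_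
    refine Finset.sum_eq_single e.2 (fun l _ hl => ?_) (fun h => absurd (Finset.mem_univ _) h)
    by_contra hne
    exact hl ((hz l e (left_ne_zero_of_mul hne)).1).symm
  · have h1 : (2 : ℝ) ^ (j * d) ≤ ∏ l', (S e.2 l' : ℝ) := by
      calc (2 : ℝ) ^ (j * d) = ∏ _l' : Fin d, (2 : ℝ) ^ j := by simp [pow_mul]
        _ ≤ _ := by
          refine Finset.prod_le_prod (fun _ _ => by positivity) fun l' _ => ?_
          simp only [hS]
          split_ifs
          · push_cast
            exact pow_le_pow_right₀ one_le_two (Nat.le_succ j)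
          · push_cast
            exact le_rfl
    have h2 : (S e.2 e.2 : ℝ) = 2 ^ j := by simp [hS]
    rw [h2]
    gcongr
  · have h1 := (hz _ e he).2 l
    obtain ⟨m, hm⟩ := hSdvd (e.2 + 1) l
    rw [hm, ← Nat.div_div_eq_div_mul, ← Nat.div_div_eq_div_mul, h1]

theorem card_sameBox_le {d J : ℕ} (m : ℕ) (hm : 0 < m) (z : Fin d → ℕ) :
    ((gridCells d J).filter fun c => ∀ l, z l / m = c l / m).card ≤ m ^ d := by
  classical
  calc _ ≤ (Fintype.piFinset fun l : Fin d =>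
          Finset.Ico (m * (z l / m)) (m * (z l / m) + m)).card := by
        refine Finset.card_le_card fun c hc => ?_
        have h1 := (Finset.mem_filter.1 hc).2
        refine Fintype.mem_piFinset.2 fun l => Finset.mem_Ico.2 ?_
        rw [h1 l]
        exact ⟨Nat.mul_div_le _ _, Nat.lt_mul_div_succ _ hm⟩
    _ = m ^ d := by simp

/-- The weights `2 ^ j / 2 ^ (j d)` of the dyadic cubes that contain both `c` and `z` are square
summable in `c`, up to a factor `J`: this is where `d ≥ 2` enters. -/
theorem sum_sq_sum_weights_le {d J : ℕ} (hd : 2 ≤ d) (z : Fin d → ℕ) (m : ℕ) :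
    ∑ c ∈ gridCells d J, (∑ j ∈ Finset.range m,
      if ∀ l, z l / 2 ^ (j + 1) = c l / 2 ^ (j + 1) then ((2 : ℝ) ^ (j * d))⁻¹ * 2 ^ j else 0) ^ 2
      ≤ 3 * 2 ^ d * m := by
  classical
  set I : ℕ → (Fin d → ℕ) → Prop := fun j c => ∀ l, z l / 2 ^ (j + 1) = c l / 2 ^ (j + 1) with hI
  set w : ℕ → ℝ := fun j => ((2 : ℝ) ^ (j * d))⁻¹ * 2 ^ j with hw
  have hw0 : ∀ j, 0 ≤ w j := fun j => by positivity
  have hcard : ∀ j, ∑ c ∈ gridCells d J, (if I j c then w j else 0) ≤ 2 ^ d * 2 ^ j := fun j => by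
    rw [← Finset.sum_filter, Finset.sum_const, nsmul_eq_mul]
    have h1 : (((gridCells d J).filter (I j)).card : ℝ) ≤ (2 ^ (j + 1)) ^ d := by
      exact_mod_cast card_sameBox_le (2 ^ (j + 1)) (by positivity) z
    calc _ ≤ (2 ^ (j + 1)) ^ d * w j := by gcongr
      _ = 2 ^ d * 2 ^ j * ((2 : ℝ) ^ (j * d) * ((2 : ℝ) ^ (j * d))⁻¹) := by
        simp only [hw, pow_succ, mul_pow, ← pow_mul]; ring
      _ = 2 ^ d * 2 ^ j := by rw [mul_inv_cancel₀ (by positivity), mul_one]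
  have hw1 : ∀ j, w j * 2 ^ j ≤ 1 := fun j => by
    have h1 : w j * 2 ^ j = (2 : ℝ) ^ (j * 2) / 2 ^ (j * d) := by
      simp only [hw, pow_mul, div_eq_inv_mul]
      ring
    rw [h1, div_le_one (by positivity)]
    exact pow_le_pow_right₀ one_le_two (Nat.mul_le_mul_left _ hd)
  change ∑ c ∈ gridCells d J, (∑ j ∈ Finset.range m, if I j c then w j else 0) ^ 2 ≤ _
  induction m with
  | zero => simp
  | succ m ih =>
    have hexp : ∀ c, (∑ j ∈ Finset.range (m + 1), if I j c then w j else 0) ^ 2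
        ≤ (∑ j ∈ Finset.range m, if I j c then w j else 0) ^ 2
          + 2 * w m * (∑ j ∈ Finset.range m, if I j c then w j else 0)
          + w m * (if I m c then w m else 0) := fun c => by
      rw [Finset.sum_range_succ]
      have h0 : 0 ≤ ∑ j ∈ Finset.range m, if I j c then w j else 0 :=
        Finset.sum_nonneg fun j _ => by split_ifs; exacts [hw0 j, le_rfl]
      split_ifs
      · nlinarith
      · have := mul_nonneg (hw0 m) h0
        nlinarith
    have hgeom : ∑ c ∈ gridCells d J, ∑ j ∈ Finset.range m, (if I j c then w j else 0)
        ≤ 2 ^ d * 2 ^ m := by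
      rw [Finset.sum_comm]
      calc _ ≤ ∑ j ∈ Finset.range m, (2 : ℝ) ^ d * 2 ^ j := Finset.sum_le_sum fun j _ => hcard j
        _ = 2 ^ d * (2 ^ m - 1) := by
          rw [← Finset.mul_sum, geom_sum_eq (by norm_num)]; norm_num
        _ ≤ _ := by gcongr; linarith
    calc _ ≤ ∑ c ∈ gridCells d J, _ := Finset.sum_le_sum fun c _ => hexp c
      _ = ∑ c ∈ gridCells d J, (∑ j ∈ Finset.range m, if I j c then w j else 0) ^ 2
          + 2 * w m * (∑ c ∈ gridCells d J, ∑ j ∈ Finset.range m, if I j c then w j else 0)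
          + w m * ∑ c ∈ gridCells d J, (if I m c then w m else 0) := by
        rw [Finset.sum_add_distrib, Finset.sum_add_distrib, Finset.mul_sum, Finset.mul_sum]
      _ ≤ 3 * 2 ^ d * m + 2 * w m * (2 ^ d * 2 ^ m) + w m * (2 ^ d * 2 ^ m) := by
        have := hw0 m
        gcongr
        exact hcard m
      _ = 3 * 2 ^ d * m + 3 * 2 ^ d * (w m * 2 ^ m) := by ring
      _ ≤ 3 * 2 ^ d * m + 3 * 2 ^ d * 1 := by gcongr; exact hw1 m
      _ = 3 * 2 ^ d * ((m + 1 : ℕ) : ℝ) := by push_cast; ring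

/-- A left inverse of the grid gradient on mean-zero functions, whose columns have squared
Euclidean norm `O(J)`, the logarithm of the side length. -/
theorem exists_gridKernel {d : ℕ} (hd : 2 ≤ d) (J : ℕ) :
    ∃ G : (Fin d → ℕ) → (Fin d → ℕ) × Fin d → ℝ,
      (∀ u, ∀ c ∈ gridCells d J, u c - ((2 : ℝ) ^ (J * d))⁻¹ * ∑ z ∈ gridCells d J, u z
        = ∑ e ∈ gridEdges d J, G c e * gridDiff u e) ∧
      ∀ e, ∑ c ∈ gridCells d J, G c e ^ 2 ≤ 3 * 2 ^ d * J := by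
  classical
  have hstep := fun (j : Fin J) (c : gridCells d J) =>
    boxAverage_sub_boxAverage_succ j.2 c.1 c.2
  choose g hg hb hz using hstep
  refine ⟨fun c e => if hc : c ∈ gridCells d J then ∑ j, g j ⟨c, hc⟩ e else 0,
    fun u c hc => ?_, fun e => ?_⟩
  · simp only [hc, dif_pos, Finset.sum_mul]
    rw [Finset.sum_comm]
    simp only [← hg]
    rw [Fin.sum_univ_eq_sum_range
      (fun j => boxAverage (boxCorner (fun _ => 2 ^ j) c) (fun _ => 2 ^ j) u
          - boxAverage (boxCorner (fun _ => 2 ^ (j + 1)) c) (fun _ => 2 ^ (j + 1)) u) J,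
      Finset.sum_range_sub']
    congr 1
    · simp only [boxAverage]
      have : (Fintype.piFinset fun _ : Fin d => Finset.range (2 ^ 0)) = {0} := by
        ext t
        simp [funext_iff]
      have h1 : boxCorner (fun _ => 2 ^ 0) c = c := by
        ext l
        simp [boxCorner]
      rw [this, h1]
      simp
    · have h0 : boxCorner (fun _ => 2 ^ J) c = 0 := by
        ext l
        simp [boxCorner, Nat.div_eq_of_lt (mem_gridCells.1 hc l)]
      simp [boxAverage, h0, gridCells, pow_mul]
  · refine le_trans (Finset.sum_le_sum fun c hc => ?_) (sum_sq_sum_weights_le hd e.1 J)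
    simp only [hc, dif_pos]
    rw [← sq_abs]
    gcongr
    rw [← Fin.sum_univ_eq_sum_range (fun j => if ∀ l, e.1 l / 2 ^ (j + 1) = c l / 2 ^ (j + 1) then
      ((2 : ℝ) ^ (j * d))⁻¹ * 2 ^ j else 0)]
    refine (Finset.abs_sum_le_sum_abs _ _).trans (Finset.sum_le_sum fun j _ => ?_)
    split_ifs with h
    · exact hb j ⟨c, hc⟩ e
    · have : g j ⟨c, hc⟩ e = 0 := by
        by_contra hne
        exact h (hz j ⟨c, hc⟩ e hne)
      simp [this]

/-! ### Nearest neighbours and prediction -/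

section NearestNeighbours

variable {X : Type u} [MetricSpace X] {n : ℕ}

theorem NearerTo.trans {z : Fin n → X} {q : X} {i j k : Fin n} (h : NearerTo z q i j)
    (h' : NearerTo z q j k) : NearerTo z q i k := by
  rcases h with h | ⟨h, h1⟩ <;> rcases h' with h' | ⟨h', h1'⟩
  · exact Or.inl (h.trans h')
  · exact Or.inl (h' ▸ h)
  · exact Or.inl (h ▸ h')
  · exact Or.inr ⟨h.trans h', h1.trans h1'⟩

theorem NearerTo.irrefl (z : Fin n → X) (q : X) (i : Fin n) : ¬ NearerTo z q i i := by
  rintro (h | ⟨-, h⟩) <;> exact lt_irrefl _ h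

theorem NearerTo.total {z : Fin n → X} {q : X} {i j : Fin n} (h : i ≠ j) :
    NearerTo z q i j ∨ NearerTo z q j i := by
  rcases lt_trichotomy (dist (z i) q) (dist (z j) q) with h1 | h1 | h1
  · exact Or.inl (Or.inl h1)
  · rcases h.lt_or_gt with h2 | h2
    · exact Or.inl (Or.inr ⟨h1, h2⟩)
    · exact Or.inr (Or.inr ⟨h1.symm, h2⟩)
  · exact Or.inr (Or.inl h1)

/-- The rank of an index in the list of all indices ordered by distance from `q` is a bijection
onto `{0, …, n - 1}`. -/
theorem card_nearestNeighbors (z : Fin n → X) {K : ℕ} (hK : K ≤ n) (q : X) :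
    (nearestNeighbors z K q).card = K := by
  classical
  set rk : Fin n → ℕ := fun j => (Finset.univ.filter fun i => NearerTo z q i j).card with hrk
  have hmono : ∀ i j, NearerTo z q i j → rk i < rk j := fun i j h => by
    refine Finset.card_lt_card (Finset.ssubset_iff_of_subset (fun k hk => ?_) |>.2 ⟨i, ?_, ?_⟩)
    · exact Finset.mem_filter.2 ⟨Finset.mem_univ _, (Finset.mem_filter.1 hk).2.trans h⟩
    · exact Finset.mem_filter.2 ⟨Finset.mem_univ _, h⟩
    · exact fun h' => NearerTo.irrefl z q i (Finset.mem_filter.1 h').2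
  have hinj : Function.Injective rk := fun i j h => by
    by_contra hne
    rcases NearerTo.total (z := z) (q := q) hne with h' | h'
    · exact (hmono _ _ h').ne h
    · exact (hmono _ _ h').ne h.symm
  have hlt : ∀ j, rk j < n := fun j => by
    have : rk j < (Finset.univ : Finset (Fin n)).card := Finset.card_lt_card
      (Finset.filter_ssubset.2 ⟨j, Finset.mem_univ _, NearerTo.irrefl z q j⟩)
    simpa using this
  have himg : Finset.univ.image rk = Finset.range n :=
    Finset.eq_of_subset_of_card_le
      (fun m hm => by
        obtain ⟨j, -, rfl⟩ := Finset.mem_image.1 hm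
        exact Finset.mem_range.2 (hlt j))
      (by rw [Finset.card_image_of_injective _ hinj]; simp)
  have hset : nearestNeighbors z K q = Finset.univ.filter fun j => rk j < K := by
    ext j
    simp only [nearestNeighbors, nearestIn, Finset.mem_filter, hrk]
  rw [hset, ← Finset.card_image_of_injective _ hinj]
  have : (Finset.univ.filter fun j => rk j < K).image rk = Finset.range K := by
    ext m
    simp only [Finset.mem_image, Finset.mem_filter, Finset.mem_univ, true_and, Finset.mem_range]
    constructor
    · rintro ⟨j, h, rfl⟩
      exact h
    · intro h
      have : m ∈ Finset.univ.image rk := himg ▸ Finset.mem_range.2 (h.trans_le hK)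
      obtain ⟨j, -, rfl⟩ := Finset.mem_image.1 this
      exact ⟨j, h, rfl⟩
  rw [this, Finset.card_range]

/-- If a ball around `z j` holds at most `K` sample points, all of them are neighbours of `j`. -/
theorem knnGraph_adj_of_dist_le (z : Fin n → X) {K : ℕ} {i j : Fin n} (hij : i ≠ j) {ρ : ℝ}
    (hd : dist (z i) (z j) ≤ ρ) (S : Finset (Fin n)) (hS : ∀ k, dist (z k) (z j) ≤ ρ → k ∈ S)
    (hcard : S.card ≤ K) : (knnGraph z K).Adj i j := by
  classical
  rw [knnGraph, SimpleGraph.fromRel_adj]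
  refine ⟨hij, Or.inl ?_⟩
  simp only [nearestIn, Finset.mem_filter, Finset.mem_erase, Finset.mem_univ, and_true]
  refine ⟨hij, lt_of_lt_of_le (Finset.card_lt_card (Finset.ssubset_iff_of_subset
    (fun k hk => ?_) |>.2 ⟨i, hS i hd, fun h => ?_⟩)) hcard⟩
  · rcases (Finset.mem_filter.1 hk).2 with h | ⟨h, -⟩
    · exact hS k (h.le.trans hd)
    · exact hS k (h.le.trans hd)
  · exact NearerTo.irrefl z _ i (Finset.mem_filter.1 h).2

/-- If a ball around `q` holds at least `K` sample points, it holds the `K` nearest ones. -/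
theorem dist_le_of_mem_nearestNeighbors (z : Fin n → X) {K : ℕ} {q : X} {ρ : ℝ}
    (S : Finset (Fin n)) (hS : ∀ k ∈ S, dist (z k) q ≤ ρ) (hcard : K ≤ S.card) {i : Fin n}
    (hi : i ∈ nearestNeighbors z K q) : dist (z i) q ≤ ρ := by
  classical
  by_contra! h
  simp only [nearestNeighbors, nearestIn, Finset.mem_filter, Finset.mem_univ, true_and] at hi
  refine absurd hcard (not_le.2 (lt_of_le_of_lt (Finset.card_le_card fun k hk => ?_) hi))
  exact Finset.mem_filter.2 ⟨Finset.mem_univ _, Or.inl ((hS k hk).trans_lt h)⟩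

/-- The prediction error exceeds the approximation error by the estimation error at the sample
points, provided that the set of points having `i` among their nearest neighbours lies in a ball
of mass at most `V` around `z i`. -/
theorem integratedSqError_knnPredict_le [MeasurableSpace X] [BorelSpace X] (ν : Measure X)
    (f₀ : X → ℝ) (z : Fin n → X) {K : ℕ} (hK0 : 0 < K) (hK : K ≤ n) (η : Fin n → ℝ) {ρ V : ℝ}
    (hV : 0 ≤ V) (hρ : ∀ q, ∀ i ∈ nearestNeighbors z K q, dist (z i) q ≤ ρ)
    (hball : ∀ i, ν (Metric.closedBall (z i) ρ) ≤ ENNReal.ofReal V) :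
    integratedSqError ν f₀ (knnPredict z K η)
      ≤ 2 * approxError ν f₀ z K
        + ENNReal.ofReal (2 * V / K * ∑ i, (f₀ (z i) - η i) ^ 2) := by
  have hK' : (0 : ℝ) < K := by exact_mod_cast hK0
  set w : Fin n → ℝ := fun i => (f₀ (z i) - η i) ^ 2 with hw
  set g : X → ℝ≥0∞ := fun q =>
    ∑ i, (Metric.closedBall (z i) ρ).indicator (fun _ => ENNReal.ofReal (2 / K * w i)) q with hg
  have hpt : ∀ q, ENNReal.ofReal ((f₀ q - knnPredict z K η q) ^ 2)
      ≤ 2 * ENNReal.ofReal ((f₀ q - 1 / (K : ℝ) * ∑ i ∈ nearestNeighbors z K q, f₀ (z i)) ^ 2)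
        + g q := fun q => by
    set N := nearestNeighbors z K q with hN
    have hNc : N.card = K := card_nearestNeighbors z hK q
    set a := f₀ q - 1 / (K : ℝ) * ∑ i ∈ N, f₀ (z i) with ha
    set b := 1 / (K : ℝ) * ∑ i ∈ N, (f₀ (z i) - η i) with hb
    have hab : f₀ q - knnPredict z K η q = a + b := by
      rw [knnPredict, ← hN, hNc, ha, hb, Finset.sum_sub_distrib]
      ring
    have hb2 : b ^ 2 ≤ 1 / K * ∑ i ∈ N, w i := by
      have h := sq_sum_le_card_mul_sum_sq (s := N) (f := fun i => f₀ (z i) - η i)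
      rw [hNc] at h
      calc b ^ 2 = (1 / K) ^ 2 * (∑ i ∈ N, (f₀ (z i) - η i)) ^ 2 := by rw [hb]; ring
        _ ≤ (1 / K) ^ 2 * (K * ∑ i ∈ N, w i) := by gcongr
        _ = 1 / K * ∑ i ∈ N, w i := by field_simp
    have hgq : ENNReal.ofReal (2 * (1 / K * ∑ i ∈ N, w i)) ≤ g q := by
      have h1 : 2 * (1 / K * ∑ i ∈ N, w i) = ∑ i ∈ N, 2 / K * w i := by
        rw [Finset.mul_sum, Finset.mul_sum]
        exact Finset.sum_congr rfl fun i _ => by ring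
      rw [h1, ENNReal.ofReal_sum_of_nonneg fun i _ => by positivity]
      calc _ = ∑ i ∈ N, (Metric.closedBall (z i) ρ).indicator
            (fun _ => ENNReal.ofReal (2 / K * w i)) q := by
            refine Finset.sum_congr rfl fun i hi => ?_
            rw [Set.indicator_of_mem]
            rw [Metric.mem_closedBall, dist_comm]
            exact hρ q i hi
        _ ≤ g q := Finset.sum_le_sum_of_subset (Finset.subset_univ _)
    calc _ ≤ ENNReal.ofReal (2 * a ^ 2 + 2 * (1 / K * ∑ i ∈ N, w i)) := by
          refine ENNReal.ofReal_le_ofReal ?_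
          rw [hab]
          nlinarith [sq_nonneg (a - b)]
      _ = 2 * ENNReal.ofReal (a ^ 2) + ENNReal.ofReal (2 * (1 / K * ∑ i ∈ N, w i)) := by
          rw [ENNReal.ofReal_add (by positivity) (by positivity),
            ENNReal.ofReal_mul zero_le_two, ENNReal.ofReal_ofNat]
      _ ≤ _ := by gcongr
  have hgm : Measurable g := by
    refine Finset.measurable_sum _ fun i _ => ?_
    exact measurable_const.indicator Metric.isClosed_closedBall.measurableSet
  calc integratedSqError ν f₀ (knnPredict z K η)
      ≤ ∫⁻ q, (2 * ENNReal.ofReal ((f₀ q - 1 / (K : ℝ) *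
          ∑ i ∈ nearestNeighbors z K q, f₀ (z i)) ^ 2) + g q) ∂ν := lintegral_mono hpt
    _ = 2 * approxError ν f₀ z K + ∫⁻ q, g q ∂ν := by
        rw [lintegral_add_right _ hgm, lintegral_const_mul' _ _ (by norm_num)]
        rfl
    _ ≤ _ := by
        refine add_le_add le_rfl ?_
        rw [lintegral_finsetSum _ fun i _ =>
          measurable_const.indicator Metric.isClosed_closedBall.measurableSet]
        have h1 : 2 * V / K * ∑ i, (f₀ (z i) - η i) ^ 2 = ∑ i, 2 / K * w i * V := by
          rw [Finset.mul_sum]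
          exact Finset.sum_congr rfl fun i _ => by ring
        rw [h1, ENNReal.ofReal_sum_of_nonneg fun i _ => by positivity]
        refine Finset.sum_le_sum fun i _ => ?_
        rw [lintegral_indicator_const Metric.isClosed_closedBall.measurableSet,
          ENNReal.ofReal_mul (p := 2 / K * w i) (by positivity)]
        exact mul_le_mul' le_rfl (hball i)

end NearestNeighbours

/-! ### Sub-Gaussian noise -/

section Noise

variable {Ω : Type v} [MeasurableSpace Ω] {P : Measure Ω}

theorem lintegral_one_add_inv_sq :
    ∫⁻ t in Set.Ioi (0 : ℝ), ENNReal.ofReal (((1 + t) ^ 2)⁻¹) = 1 := by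
  have hder : ∀ t ∈ Set.Ici (0 : ℝ), HasDerivAt (fun t : ℝ => -(1 + t)⁻¹) (((1 + t) ^ 2)⁻¹) t := by
    intro t ht
    have h0 : 1 + t ≠ 0 := by
      have : (0 : ℝ) ≤ t := ht
      positivity
    have h := ((hasDerivAt_id t).const_add 1).inv h0
    convert! h.neg using 1
    simp [div_eq_mul_inv]
  have hlim : Tendsto (fun t : ℝ => -(1 + t)⁻¹) atTop (nhds 0) := by
    have : Tendsto (fun t : ℝ => (1 + t)⁻¹) atTop (nhds 0) :=
      tendsto_inv_atTop_zero.comp (tendsto_atTop_add_const_left _ _ tendsto_id)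
    simpa using this.neg
  have hint := integrableOn_Ioi_deriv_of_nonneg' hder (fun t _ => by positivity) hlim
  rw [← ofReal_integral_eq_lintegral_ofReal hint (ae_of_all _ fun t => by positivity),
    integral_Ioi_of_hasDerivAt_of_tendsto' hder hint hlim]
  simp

/-- The exponential square moment of a variable with Gaussian tails, by the layer cake formula. -/
theorem lintegral_exp_sq_sub_one_le {Y : Ω → ℝ} (hY : Measurable Y) {C σ : ℝ} (hC : 0 < C)
    (hσ : 0 < σ) (htail : ∀ t : ℝ, 0 < t →
      P {ω | t < |Y ω|} ≤ ENNReal.ofReal (C * Real.exp (-t ^ 2 / (2 * σ ^ 2)))) :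
    ∫⁻ ω, ENNReal.ofReal (Real.exp (Y ω ^ 2 / (4 * σ ^ 2)) - 1) ∂P ≤ ENNReal.ofReal C := by
  have hσ2 : 0 < 4 * σ ^ 2 := by positivity
  rw [lintegral_eq_lintegral_meas_lt P (ae_of_all _ fun ω => by
    simp only [Pi.zero_apply, sub_nonneg, Real.one_le_exp_iff]; positivity) (by fun_prop)]
  calc _ ≤ ∫⁻ t in Set.Ioi (0 : ℝ), ENNReal.ofReal C * ENNReal.ofReal (((1 + t) ^ 2)⁻¹) := by
        refine setLIntegral_mono' measurableSet_Ioi fun t ht => ?_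
        have ht0 : (0 : ℝ) < t := ht
        have hlog : 0 < Real.log (1 + t) := Real.log_pos (by linarith)
        have hs : 0 < Real.sqrt (4 * σ ^ 2 * Real.log (1 + t)) := by positivity
        have hs2 := Real.sq_sqrt (show 0 ≤ 4 * σ ^ 2 * Real.log (1 + t) by positivity)
        refine (measure_mono fun ω hω => ?_).trans ((htail _ hs).trans ?_)
        · have h1 : 1 + t < Real.exp (Y ω ^ 2 / (4 * σ ^ 2)) := by
            have : t < Real.exp (Y ω ^ 2 / (4 * σ ^ 2)) - 1 := hω
            linarith
          rw [← Real.log_lt_iff_lt_exp (by linarith), lt_div_iff₀ hσ2] at h1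
          change _ < |Y ω|
          rw [← Real.sqrt_sq_eq_abs]
          exact Real.sqrt_lt_sqrt (by positivity) (by linarith)
        · rw [hs2, ← ENNReal.ofReal_mul hC.le]
          refine ENNReal.ofReal_le_ofReal (le_of_eq ?_)
          congr 1
          have : -(4 * σ ^ 2 * Real.log (1 + t)) / (2 * σ ^ 2) = -(2 * Real.log (1 + t)) := by
            field_simp; ring
          rw [this, Real.exp_neg, two_mul, Real.exp_add, Real.exp_log (by linarith), sq]
    _ = ENNReal.ofReal C := by
        rw [lintegral_const_mul' _ _ ENNReal.ofReal_ne_top, lintegral_one_add_inv_sq, mul_one]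

theorem exp_le_add_exp_sq (x : ℝ) : Real.exp x ≤ x + Real.exp (x ^ 2) := by
  have h0 := Real.add_one_le_exp (x ^ 2)
  rcases le_or_gt |x| 1 with h | h
  · have h1 := (abs_le.1 (Real.abs_exp_sub_one_sub_id_le h)).2
    linarith
  · rcases lt_abs.1 h with h | h
    · have : Real.exp x ≤ Real.exp (x ^ 2) := Real.exp_le_exp.2 (by nlinarith)
      linarith
    · have : Real.exp x ≤ 1 := Real.exp_le_one_iff.2 (by linarith)
      nlinarith

/-- A centred variable with Gaussian tails has a sub-Gaussian moment generating function. -/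
theorem hasSubgaussianMGF_of_tail [IsProbabilityMeasure P] {Y : Ω → ℝ} (hY : Measurable Y)
    {C σ : ℝ} (hC : 0 < C) (hσ : 0 < σ) (hmean : ∫ ω, Y ω ∂P = 0) (htail : ∀ t : ℝ, 0 < t →
      P {ω | t < |Y ω|} ≤ ENNReal.ofReal (C * Real.exp (-t ^ 2 / (2 * σ ^ 2)))) :
    HasSubgaussianMGF Y (8 * (C + 1) * σ ^ 2).toNNReal P := by
  set a : ℝ := 1 / (4 * σ ^ 2) with ha
  have ha0 : 0 < a := by positivity
  have hsq : ∀ ω, Y ω ^ 2 / (4 * σ ^ 2) = a * Y ω ^ 2 := fun ω => by rw [ha]; ring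
  have hlint := lintegral_exp_sq_sub_one_le hY hC hσ htail
  simp only [hsq] at hlint
  have hnn : ∀ ω, 0 ≤ Real.exp (a * Y ω ^ 2) - 1 := fun ω => by
    rw [sub_nonneg, Real.one_le_exp_iff]; positivity
  have hint1 : Integrable (fun ω => Real.exp (a * Y ω ^ 2) - 1) P := by
    refine ⟨by fun_prop, ?_⟩
    rw [hasFiniteIntegral_iff_ofReal (ae_of_all _ hnn)]
    exact hlint.trans_lt ENNReal.ofReal_lt_top
  have hintE : Integrable (fun ω => Real.exp (a * Y ω ^ 2)) P := by
    convert! hint1.add (integrable_const (1 : ℝ)) using 2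
    simp
  have hval1 : ∫ ω, (Real.exp (a * Y ω ^ 2) - 1) ∂P ≤ C := by
    rw [integral_eq_lintegral_of_nonneg_ae (ae_of_all _ hnn) (by fun_prop)]
    exact ENNReal.toReal_le_of_le_ofReal hC.le hlint
  have hval : ∫ ω, Real.exp (a * Y ω ^ 2) ∂P ≤ 1 + C := by
    rw [integral_sub hintE (integrable_const _)] at hval1
    simp at hval1
    linarith
  have hbd : ∀ t ω, Real.exp (t * Y ω) ≤ Real.exp (t ^ 2 / (4 * a)) * Real.exp (a * Y ω ^ 2) := by
    intro t ω
    rw [← Real.exp_add]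
    refine Real.exp_le_exp.2 ?_
    have h1 : t ^ 2 / (4 * a) + a * Y ω ^ 2 - t * Y ω = a * (Y ω - t / (2 * a)) ^ 2 := by
      field_simp; ring
    have h2 : 0 ≤ a * (Y ω - t / (2 * a)) ^ 2 := by positivity
    linarith
  have hintexp : ∀ t, Integrable (fun ω => Real.exp (t * Y ω)) P := fun t => by
    refine (hintE.const_mul (Real.exp (t ^ 2 / (4 * a)))).mono' (by fun_prop)
      (ae_of_all _ fun ω => ?_)
    rw [Real.norm_of_nonneg (Real.exp_pos _).le]
    exact hbd t ω
  have hintY : Integrable Y P := by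
    refine ((hintexp 1).add (hintexp (-1))).mono' (by fun_prop) (ae_of_all _ fun ω => ?_)
    have h1 := Real.add_one_le_exp (1 * Y ω)
    have h2 := Real.add_one_le_exp (-1 * Y ω)
    have h3 := Real.exp_pos (1 * Y ω)
    have h4 := Real.exp_pos (-1 * Y ω)
    simp only [Real.norm_eq_abs, Pi.add_apply]
    exact abs_le.2 ⟨by linarith, by linarith⟩
  refine ⟨hintexp, fun t => ?_⟩
  have hc : ((8 * (C + 1) * σ ^ 2).toNNReal : ℝ) * t ^ 2 / 2 = (C + 1) * (t ^ 2 / a) := by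
    rw [Real.coe_toNNReal _ (by positivity), ha]
    field_simp
    ring
  rw [hc, mgf]
  rcases le_or_gt (t ^ 2) a with h | h
  · -- small `t`: the linear term has mean zero and the square is handled by convexity of `exp`
    have hθ : t ^ 2 / a ≤ 1 := (div_le_one ha0).2 h
    have hθ0 : 0 ≤ t ^ 2 / a := by positivity
    have hpt : ∀ ω, Real.exp (t * Y ω)
        ≤ t * Y ω + (1 + t ^ 2 / a * (Real.exp (a * Y ω ^ 2) - 1)) := fun ω => by
      have h1 := exp_le_add_exp_sq (t * Y ω)
      have h2 := convexOn_exp.2 (Set.mem_univ (a * Y ω ^ 2)) (Set.mem_univ 0) hθ0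
        (sub_nonneg.2 hθ) (by ring)
      have h3 : (t ^ 2 / a) • (a * Y ω ^ 2) + (1 - t ^ 2 / a) • (0 : ℝ) = (t * Y ω) ^ 2 := by
        simp only [smul_eq_mul]; field_simp; ring
      rw [h3] at h2
      simp only [smul_eq_mul, Real.exp_zero] at h2
      linarith
    calc ∫ ω, Real.exp (t * Y ω) ∂P
        ≤ ∫ ω, (t * Y ω + (1 + t ^ 2 / a * (Real.exp (a * Y ω ^ 2) - 1))) ∂P :=
          integral_mono (hintexp t) ((hintY.const_mul t).add
            ((integrable_const 1).add (hint1.const_mul _))) hpt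
      _ = 1 + t ^ 2 / a * ∫ ω, (Real.exp (a * Y ω ^ 2) - 1) ∂P := by
          have h1 : Integrable (fun ω => t ^ 2 / a * (Real.exp (a * Y ω ^ 2) - 1)) P :=
            hint1.const_mul _
          have h2 : Integrable (fun ω => 1 + t ^ 2 / a * (Real.exp (a * Y ω ^ 2) - 1)) P :=
            (integrable_const (1 : ℝ)).add h1
          rw [integral_add (hintY.const_mul t) h2, integral_add (integrable_const 1) h1,
            integral_const_mul, integral_const_mul, hmean]
          simp
      _ ≤ 1 + t ^ 2 / a * C := by gcongr
      _ ≤ (C + 1) * (t ^ 2 / a) + 1 := by nlinarith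
      _ ≤ _ := Real.add_one_le_exp _
  · have h1 : 1 ≤ t ^ 2 / a := (one_le_div ha0).2 h.le
    calc ∫ ω, Real.exp (t * Y ω) ∂P
        ≤ ∫ ω, Real.exp (t ^ 2 / (4 * a)) * Real.exp (a * Y ω ^ 2) ∂P :=
          integral_mono (hintexp t) (hintE.const_mul _) (hbd t)
      _ ≤ Real.exp (t ^ 2 / (4 * a)) * (1 + C) := by
          rw [integral_const_mul]; gcongr
      _ ≤ Real.exp (t ^ 2 / (4 * a)) * Real.exp C := by
          gcongr
          linarith [Real.add_one_le_exp C]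
      _ ≤ _ := by
          rw [← Real.exp_add]
          refine Real.exp_le_exp.2 ?_
          have h2 : t ^ 2 / (4 * a) = t ^ 2 / a / 4 := by field_simp
          rw [h2]
          nlinarith

/-- Two-sided Hoeffding bound for a weighted sum of independent sub-Gaussian variables. -/
theorem measure_abs_weighted_sum_ge_le {n : ℕ} {ε : Fin n → Ω → ℝ} (hind : iIndepFun ε P)
    {c : ℝ} (hc : 0 < c) (hsub : ∀ i, HasSubgaussianMGF (ε i) c.toNNReal P) (g : Fin n → ℝ)
    {V t : ℝ} (hV : 0 < V) (hg : ∑ i, g i ^ 2 ≤ V) (ht : 0 ≤ t) :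
    P {ω | t ≤ |∑ i, ε i ω * g i|} ≤ ENNReal.ofReal (2 * Real.exp (-t ^ 2 / (2 * (c * V)))) := by
  have := hind.isProbabilityMeasure
  have hind' : iIndepFun (fun i ω => g i * ε i ω) P :=
    hind.comp (fun i y => g i * y) fun i => measurable_const_mul _
  have hsum := HasSubgaussianMGF.sum_of_iIndepFun hind' (s := Finset.univ)
    (c := fun i => (g i ^ 2).toNNReal * c.toNNReal) fun i _ => by
      rw [Real.toNNReal_of_nonneg (sq_nonneg (g i))]
      exact (hsub i).const_mul (g i)
  set c' : NNReal := ∑ i, (g i ^ 2).toNNReal * c.toNNReal with hc'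
  have hc'V : (c' : ℝ) ≤ c * V := by
    rw [hc']
    push_cast
    simp only [Real.coe_toNNReal _ (sq_nonneg _)]
    rw [← Finset.sum_mul, Real.coe_toNNReal _ hc.le, mul_comm]
    exact mul_le_mul_of_nonneg_left hg hc.le
  have hZ : HasSubgaussianMGF (fun ω => ∑ i, ε i ω * g i) (c * V).toNNReal P := by
    have h1 : HasSubgaussianMGF (fun ω => ∑ i, ε i ω * g i) c' P := by
      convert! hsum using 3
      ring
    refine ⟨h1.1, fun s => (h1.2 s).trans (Real.exp_le_exp.2 ?_)⟩
    rw [Real.coe_toNNReal _ (by positivity)]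
    gcongr
  have hu := hZ.measure_ge_le ht
  have hl := hZ.neg.measure_ge_le ht
  rw [Real.coe_toNNReal _ (by positivity)] at hu hl
  calc P {ω | t ≤ |∑ i, ε i ω * g i|}
      ≤ P ({ω | t ≤ ∑ i, ε i ω * g i} ∪ {ω | t ≤ (-fun ω => ∑ i, ε i ω * g i) ω}) :=
        measure_mono fun ω hω => by
          rcases le_abs.1 (show t ≤ |∑ i, ε i ω * g i| from hω) with h | h
          · exact Or.inl h
          · exact Or.inr h
    _ ≤ _ := measure_union_le _ _
    _ ≤ ENNReal.ofReal (Real.exp (-t ^ 2 / (2 * (c * V))))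
        + ENNReal.ofReal (Real.exp (-t ^ 2 / (2 * (c * V)))) := by
        gcongr
        · exact (ENNReal.le_ofReal_iff_toReal_le (measure_ne_top _ _) (Real.exp_pos _).le).2 hu
        · exact (ENNReal.le_ofReal_iff_toReal_le (measure_ne_top _ _) (Real.exp_pos _).le).2 hl
    _ = _ := by
        rw [← ENNReal.ofReal_add (Real.exp_pos _).le (Real.exp_pos _).le, ← two_mul]

end Noise

/-! ### Counting sample points, and conditioning on the design -/

section Counting

variable {Ω : Type v} [MeasurableSpace Ω] {P : Measure Ω} [IsProbabilityMeasure P]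
  {X : Type u} [MeasurableSpace X] {ν : Measure X} {n : ℕ} {x : Fin n → Ω → X}

theorem mgf_indicator_le {A : Set X} (hA : MeasurableSet A)
    {y : Ω → X} (hy : Measurable y) (hlaw : P.map y = ν) (t : ℝ) :
    mgf (fun ω => A.indicator (fun _ => (1 : ℝ)) (y ω)) P t
      ≤ Real.exp ((Real.exp t - 1) * ν.real A) := by
  have hpt : ∀ ω, Real.exp (t * A.indicator (fun _ => (1 : ℝ)) (y ω))
      = 1 + (Real.exp t - 1) * (y ⁻¹' A).indicator (fun _ => (1 : ℝ)) ω := fun ω => by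
    by_cases h : y ω ∈ A
    · have h' : ω ∈ y ⁻¹' A := h
      simp [h, h']
    · have h' : ω ∉ y ⁻¹' A := h
      simp [h, h']
  have hν' : P.real (y ⁻¹' A) = ν.real A := by
    rw [← hlaw, map_measureReal_apply hy hA]
  simp only [mgf, hpt]
  rw [integral_add (integrable_const _)
    (((integrable_const (1 : ℝ)).indicator (hy hA)).const_mul _), integral_const_mul,
    integral_indicator_const _ (hy hA), hν']
  simp only [integral_const, probReal_univ, smul_eq_mul, mul_one]
  linarith [Real.add_one_le_exp ((Real.exp t - 1) * ν.real A)]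

open Classical in
theorem mgf_count_le {A : Set X} (hA : MeasurableSet A)
    (hx : ∀ i, Measurable (x i)) (hlaw : ∀ i, P.map (x i) = ν) (hind : iIndepFun x P) (t : ℝ) :
    mgf (fun ω => ((Finset.univ.filter fun i => x i ω ∈ A).card : ℝ)) P t
      ≤ Real.exp ((Real.exp t - 1) * (n * ν.real A)) ∧
    Integrable (fun ω => Real.exp (t * ((Finset.univ.filter fun i => x i ω ∈ A).card : ℝ))) P := by
  have hm : Measurable (A.indicator (fun _ => (1 : ℝ))) := measurable_const.indicator hA
  have hsum : (fun ω => ((Finset.univ.filter fun i => x i ω ∈ A).card : ℝ))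
      = ∑ i, fun ω => A.indicator (fun _ => (1 : ℝ)) (x i ω) := by
    ext ω
    simp [Finset.sum_apply, Set.indicator_apply]
  have hind' : iIndepFun (fun i ω => A.indicator (fun _ => (1 : ℝ)) (x i ω)) P :=
    hind.comp (fun _ => A.indicator (fun _ => (1 : ℝ))) fun _ => hm
  have hmeas : Measurable fun ω => ((Finset.univ.filter fun i => x i ω ∈ A).card : ℝ) := by
    rw [hsum]
    have h := Finset.measurable_fun_sum Finset.univ fun i _ => hm.comp (hx i)
    convert! h using 1
    ext ω
    simp [Finset.sum_apply]
  constructor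
  · rw [hsum, hind'.mgf_sum (fun i => hm.comp (hx i))]
    calc _ ≤ ∏ _i : Fin n, Real.exp ((Real.exp t - 1) * ν.real A) :=
          Finset.prod_le_prod (fun _ _ => mgf_nonneg)
            fun i _ => mgf_indicator_le hA (hx i) (hlaw i) t
      _ = _ := by
          rw [Finset.prod_const, ← Real.exp_nat_mul]
          simp only [Finset.card_univ, Fintype.card_fin]
          congr 1
          ring
  · refine (integrable_const (Real.exp (|t| * n))).mono'
      (hmeas.const_mul t).exp.aestronglyMeasurable (ae_of_all _ fun ω => ?_)
    rw [Real.norm_of_nonneg (Real.exp_pos _).le]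
    refine Real.exp_le_exp.2 (mul_le_mul (le_abs_self t) ?_ (by positivity) (abs_nonneg t))
    exact_mod_cast (Finset.card_filter_le _ _).trans (by simp)

open Classical in
/-- Chernoff bound: a set of expected count at most `k / 4` rarely receives `k` points. -/
theorem measure_le_count_le {A : Set X} (hA : MeasurableSet A)
    (hx : ∀ i, Measurable (x i)) (hlaw : ∀ i, P.map (x i) = ν) (hind : iIndepFun x P) {k : ℕ}
    (hk : n * ν.real A ≤ k / 4) :
    P {ω | k ≤ (Finset.univ.filter fun i => x i ω ∈ A).card}
      ≤ ENNReal.ofReal (Real.exp (-k / 2)) := by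
  obtain ⟨h1, h2⟩ := mgf_count_le hA hx hlaw hind 1
  have h3 := measure_ge_le_exp_mul_mgf (k : ℝ) zero_le_one h2
  refine (ENNReal.le_ofReal_iff_toReal_le (measure_ne_top _ _) (Real.exp_pos _).le).2 ?_
  calc _ = P.real {ω | (k : ℝ) ≤ ((Finset.univ.filter fun i => x i ω ∈ A).card : ℝ)} := by
        simp only [Nat.cast_le]
        rfl
    _ ≤ _ := h3
    _ ≤ Real.exp (-1 * k) * Real.exp ((Real.exp 1 - 1) * (n * ν.real A)) := by gcongr
    _ ≤ _ := by
        rw [← Real.exp_add]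
        refine Real.exp_le_exp.2 ?_
        have he : Real.exp 1 - 1 ≤ 2 := by linarith [Real.exp_one_lt_d9]
        have h0 : 0 ≤ n * ν.real A := by positivity
        nlinarith

open Classical in
/-- Chernoff bound: a set of expected count at least `4 k` rarely receives at most `k` points. -/
theorem measure_count_le_le {A : Set X} (hA : MeasurableSet A)
    (hx : ∀ i, Measurable (x i)) (hlaw : ∀ i, P.map (x i) = ν) (hind : iIndepFun x P) {k : ℕ}
    (hk : (4 * k : ℝ) ≤ n * ν.real A) :
    P {ω | (Finset.univ.filter fun i => x i ω ∈ A).card ≤ k}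
      ≤ ENNReal.ofReal (Real.exp (-(n * ν.real A) / 4)) := by
  obtain ⟨h1, h2⟩ := mgf_count_le hA hx hlaw hind (-1)
  have h3 := measure_le_le_exp_mul_mgf (k : ℝ) (by norm_num : (-1 : ℝ) ≤ 0) h2
  refine (ENNReal.le_ofReal_iff_toReal_le (measure_ne_top _ _) (Real.exp_pos _).le).2 ?_
  calc _ = P.real {ω | ((Finset.univ.filter fun i => x i ω ∈ A).card : ℝ) ≤ (k : ℝ)} := by
        simp only [Nat.cast_le]
        rfl
    _ ≤ _ := h3
    _ ≤ Real.exp (-(-1) * k) * Real.exp ((Real.exp (-1) - 1) * (n * ν.real A)) := by gcongr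
    _ ≤ _ := by
        rw [← Real.exp_add]
        refine Real.exp_le_exp.2 ?_
        have he : Real.exp (-1) ≤ 1 / 2 := by
          rw [Real.exp_neg, inv_le_comm₀ (Real.exp_pos _) (by norm_num)]
          have := Real.add_one_le_exp (1 : ℝ)
          norm_num at this ⊢
          exact this
        have h0 : 0 ≤ n * ν.real A := by positivity
        nlinarith

/-- Conditioning on an independent discrete variable `κ`: if for each admissible value `k` of `κ`
the event `E k` has probability at most `q`, then so does the event `E κ`. -/
theorem measure_inter_le_of_indepFun {ι β : Type*} [Countable ι] [MeasurableSpace ι]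
    [MeasurableSingletonClass ι] [MeasurableSpace β] {κ : Ω → ι} {Y : Ω → β} (hκ : Measurable κ)
    (hind : IndepFun κ Y P) (good : Set ι) (E : ι → Set β) (hE : ∀ k, MeasurableSet (E k))
    {q : ℝ≥0∞} (hq : ∀ k ∈ good, P (Y ⁻¹' E k) ≤ q) :
    P {ω | κ ω ∈ good ∧ Y ω ∈ E (κ ω)} ≤ q := by
  classical
  have hmeas : ∀ k, MeasurableSet (κ ⁻¹' {k}) := fun k => hκ (measurableSet_singleton k)
  calc P {ω | κ ω ∈ good ∧ Y ω ∈ E (κ ω)}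
      ≤ P (⋃ k, if k ∈ good then κ ⁻¹' {k} ∩ Y ⁻¹' E k else ∅) :=
        measure_mono fun ω hω => Set.mem_iUnion.2 ⟨κ ω, by simp [hω.1, hω.2]⟩
    _ ≤ ∑' k, P (if k ∈ good then κ ⁻¹' {k} ∩ Y ⁻¹' E k else ∅) := measure_iUnion_le _
    _ ≤ ∑' k, P (κ ⁻¹' {k}) * q := by
        refine ENNReal.tsum_le_tsum fun k => ?_
        split_ifs with h
        · rw [hind.measure_inter_preimage_eq_mul _ _ (measurableSet_singleton k) (hE k)]
          exact mul_le_mul' le_rfl (hq k h)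
        · simp
    _ = P (⋃ k, κ ⁻¹' {k}) * q := by
        rw [ENNReal.tsum_mul_right, measure_iUnion _ hmeas]
        intro k k' h
        exact Disjoint.preimage κ (Set.disjoint_singleton.2 h)
    _ ≤ 1 * q := mul_le_mul' prob_le_one le_rfl
    _ = q := one_mul q

end Counting

/-! ### The partition of the design space into dyadic cells -/

section Cells

variable {X : Type u} [MetricSpace X] {d : ℕ}

/-- The dyadic cell of side `2 ^ (-J)` containing `w`, for `w` in the unit cube; the cells at the
upper boundary are closed. -/
def dyadicCell {d : ℕ} (J : ℕ) (w : EuclideanSpace ℝ (Fin d)) : Fin d → ℕ :=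
  fun l => min ⌊2 ^ J * w l⌋₊ (2 ^ J - 1)

theorem dyadicCell_mem (J : ℕ) (w : EuclideanSpace ℝ (Fin d)) :
    dyadicCell J w ∈ gridCells d J := by
  refine mem_gridCells.2 fun l => ?_
  have : 0 < 2 ^ J := by positivity
  simp only [dyadicCell]
  omega

theorem measurable_dyadicCell (J : ℕ) :
    Measurable (dyadicCell J : EuclideanSpace ℝ (Fin d) → Fin d → ℕ) := by
  refine measurable_pi_lambda _ fun l => ?_
  refine Measurable.min (Nat.measurable_floor.comp ?_) measurable_const
  fun_prop

theorem dyadicCell_bounds (J : ℕ) {w : EuclideanSpace ℝ (Fin d)} (hw : w ∈ unitCube d)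
    (l : Fin d) :
    (dyadicCell J w l : ℝ) ≤ 2 ^ J * w l ∧ 2 ^ J * w l ≤ dyadicCell J w l + 1 := by
  obtain ⟨h0, h1⟩ := hw l
  have hp : (0 : ℝ) < 2 ^ J := by positivity
  have hf := Nat.floor_le (show (0 : ℝ) ≤ 2 ^ J * w l by positivity)
  have hf' := Nat.lt_floor_add_one (2 ^ J * w l)
  constructor
  · exact le_trans (Nat.cast_le.2 (min_le_left _ _)) hf
  · rcases min_choice ⌊2 ^ J * w l⌋₊ (2 ^ J - 1) with h | h
    · simp only [dyadicCell, h]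
      exact hf'.le
    · simp only [dyadicCell, h]
      have h2 : ((2 ^ J - 1 : ℕ) : ℝ) + 1 = 2 ^ J := by
        rw [Nat.cast_sub Nat.one_le_two_pow]
        push_cast
        ring
      rw [h2]
      nlinarith

theorem norm_le_of_forall_abs_le {v : EuclideanSpace ℝ (Fin d)} {b : ℝ}
    (hb : 0 ≤ b) (h : ∀ l, |v l| ≤ b) : ‖v‖ ≤ d * b := by
  rw [EuclideanSpace.norm_eq]
  refine Real.sqrt_le_iff.2 ⟨by positivity, ?_⟩
  calc ∑ l, ‖v l‖ ^ 2 ≤ ∑ _l : Fin d, b ^ 2 := Finset.sum_le_sum fun l _ => by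
        have := h l
        rw [Real.norm_eq_abs]
        gcongr
    _ = d * b ^ 2 := by simp
    _ ≤ (d * b) ^ 2 := by
        rw [mul_pow]
        gcongr
        rcases Nat.eq_zero_or_pos d with h0 | h0
        · simp [h0]
        · have : (1 : ℝ) ≤ d := by exact_mod_cast h0
          nlinarith

theorem densityLaw_closedBall_le [MeasurableSpace X] [BorelSpace X] {μ : Measure X} {p : X → ℝ}
    {pmin pmax r₀ c₁ c₂ : ℝ} (hp : IsBoundedDensity μ p pmin pmax)
    (hball : HasBallVolume μ d r₀ c₁ c₂) (hpmax : 0 ≤ pmax) (q : X) {s : ℝ} (hs : 0 < s)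
    (hs' : s < r₀) :
    densityLaw μ p (Metric.closedBall q s) ≤ ENNReal.ofReal (pmax * (c₂ * s ^ d)) := by
  rw [densityLaw, withDensity_apply _ Metric.isClosed_closedBall.measurableSet,
    ENNReal.ofReal_mul hpmax]
  calc _ ≤ ∫⁻ _q in Metric.closedBall q s, ENNReal.ofReal pmax ∂μ :=
        lintegral_mono fun q => ENNReal.ofReal_le_ofReal (hp.upper q).le
    _ = ENNReal.ofReal pmax * μ (Metric.closedBall q s) := by simp
    _ ≤ _ := mul_le_mul' le_rfl (hball q s hs hs').2

theorem le_densityLaw_closedBall [MeasurableSpace X] [BorelSpace X] {μ : Measure X} {p : X → ℝ}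
    {pmin pmax r₀ c₁ c₂ : ℝ} (hp : IsBoundedDensity μ p pmin pmax)
    (hball : HasBallVolume μ d r₀ c₁ c₂) (hpmin : 0 ≤ pmin) (q : X) {s : ℝ} (hs : 0 < s)
    (hs' : s < r₀) :
    ENNReal.ofReal (pmin * (c₁ * s ^ d)) ≤ densityLaw μ p (Metric.closedBall q s) := by
  rw [densityLaw, withDensity_apply _ Metric.isClosed_closedBall.measurableSet,
    ENNReal.ofReal_mul hpmin]
  calc _ ≤ ENNReal.ofReal pmin * μ (Metric.closedBall q s) :=
        mul_le_mul' le_rfl (hball q s hs hs').1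
    _ = ∫⁻ _q in Metric.closedBall q s, ENNReal.ofReal pmin ∂μ := by simp
    _ ≤ _ := lintegral_mono fun q => ENNReal.ofReal_le_ofReal (hp.lower q).le

theorem isProbabilityMeasure_densityLaw {X : Type u} [MeasurableSpace X] {μ : Measure X} {p : X → ℝ}
    {pmin pmax : ℝ} (hp : IsBoundedDensity μ p pmin pmax) :
    IsProbabilityMeasure (densityLaw μ p) :=
  ⟨by rw [densityLaw, withDensity_apply _ MeasurableSet.univ, Measure.restrict_univ,
    hp.lintegral_eq_one]⟩

/-- The dyadic partition of the cube, pulled back to `X`: neighbouring cells lie close together,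
and every cell contains a ball of comparable size, hence has mass of order `2 ^ (-J d)`. -/
theorem exists_cellMap [MeasurableSpace X] [BorelSpace X] {μ : Measure X} {p : X → ℝ}
    {pmin pmax r₀ c₁ c₂ Lmin Lmax : ℝ} (hp : IsBoundedDensity μ p pmin pmax)
    (hball : HasBallVolume μ d r₀ c₁ c₂) (hpmin : 0 ≤ pmin) (hLmin : 0 < Lmin) (hLmax : 0 < Lmax)
    (hX : IsBilipschitzCube X d Lmin Lmax) (J : ℕ) (hJ : (4 * Lmax)⁻¹ * (2 ^ J)⁻¹ < r₀) :
    ∃ cell : X → Fin d → ℕ, Measurable cell ∧ (∀ q, cell q ∈ gridCells d J) ∧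
      (∀ q q', (∀ l, cell q l ≤ cell q' l + 1 ∧ cell q' l ≤ cell q l + 1) →
        dist q q' ≤ 2 * d / Lmin * (2 ^ J)⁻¹) ∧
      (∀ c ∈ gridCells d J, ∃ q, cell q = c) ∧
      ∀ c ∈ gridCells d J, pmin * c₁ * (4 * Lmax)⁻¹ ^ d * (2 ^ (J * d))⁻¹
        ≤ (densityLaw μ p).real (cell ⁻¹' {c}) := by
  have hν := isProbabilityMeasure_densityLaw hp
  obtain ⟨h, hh⟩ := hX
  have h2J : (0 : ℝ) < 2 ^ J := by positivity
  have hm : Measurable fun q => dyadicCell J (h q : EuclideanSpace ℝ (Fin d)) := by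
    refine (measurable_dyadicCell J).comp ?_
    exact (continuous_subtype_val.comp h.continuous).measurable
  -- the preimage of the centre of a cell, with a small ball around it inside the cell
  have hcentre : ∀ c ∈ gridCells d J, ∃ q₀ : X, ∀ q, dist q q₀ ≤ (4 * Lmax)⁻¹ * (2 ^ J)⁻¹ →
      dyadicCell J (h q : EuclideanSpace ℝ (Fin d)) = c := by
    intro c hc
    have hc' := mem_gridCells.1 hc
    set w : EuclideanSpace ℝ (Fin d) := WithLp.toLp 2 fun l => ((c l : ℝ) + 1 / 2) / 2 ^ J with hw
    have hwc : w ∈ unitCube d := fun l => by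
      have h1 : (c l : ℝ) + 1 ≤ 2 ^ J := by exact_mod_cast hc' l
      simp only [hw]
      exact ⟨by positivity, (div_le_one h2J).2 (by linarith)⟩
    refine ⟨h.symm ⟨w, hwc⟩, fun q hq => ?_⟩
    have h1 := (hh q (h.symm ⟨w, hwc⟩)).2
    rw [h.apply_symm_apply] at h1
    have h2 : ∀ l, |2 ^ J * (h q : EuclideanSpace ℝ (Fin d)) l - (c l + 1 / 2)| ≤ 1 / 4 := by
      intro l
      have h3 := PiLp.norm_apply_le ((h q : EuclideanSpace ℝ (Fin d)) - w) l
      have h4 : ‖(h q : EuclideanSpace ℝ (Fin d)) - w‖ ≤ 1 / 4 * (2 ^ J)⁻¹ := by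
        refine h1.trans ((mul_le_mul_of_nonneg_left hq hLmax.le).trans (le_of_eq ?_))
        field_simp
      have h5 : 2 ^ J * (h q : EuclideanSpace ℝ (Fin d)) l - (c l + 1 / 2)
          = 2 ^ J * ((h q : EuclideanSpace ℝ (Fin d)) - w) l := by
        simp only [hw, PiLp.sub_apply]
        field_simp
      rw [h5, abs_mul, abs_of_pos h2J, ← Real.norm_eq_abs]
      calc _ ≤ 2 ^ J * (1 / 4 * ((2 : ℝ) ^ J)⁻¹) := by gcongr; exact h3.trans h4
        _ = 1 / 4 := by field_simp
    ext l
    obtain ⟨h3, h4⟩ := abs_le.1 (h2 l)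
    have h5 : ⌊2 ^ J * (h q : EuclideanSpace ℝ (Fin d)) l⌋₊ = c l := by
      rw [Nat.floor_eq_iff (by have : (0 : ℝ) ≤ c l := Nat.cast_nonneg _; linarith)]
      constructor <;> linarith
    have := hc' l
    simp only [dyadicCell, h5]
    omega
  refine ⟨fun q => dyadicCell J (h q : EuclideanSpace ℝ (Fin d)), hm,
    fun q => dyadicCell_mem J _, fun q q' hqq => ?_, fun c hc => ?_, fun c hc => ?_⟩
  · have h1 := (hh q q').1
    have h2 : ‖(h q : EuclideanSpace ℝ (Fin d)) - h q'‖ ≤ d * (2 * (2 ^ J)⁻¹) := by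
      refine norm_le_of_forall_abs_le (by positivity) fun l => ?_
      obtain ⟨b1, b2⟩ := dyadicCell_bounds J (h q).2 l
      obtain ⟨b3, b4⟩ := dyadicCell_bounds J (h q').2 l
      have e1 : ((dyadicCell J (h q : EuclideanSpace ℝ (Fin d)) l : ℕ) : ℝ)
        ≤ dyadicCell J (h q' : EuclideanSpace ℝ (Fin d)) l + 1 := by exact_mod_cast (hqq l).1
      have e2 : ((dyadicCell J (h q' : EuclideanSpace ℝ (Fin d)) l : ℕ) : ℝ)
        ≤ dyadicCell J (h q : EuclideanSpace ℝ (Fin d)) l + 1 := by exact_mod_cast (hqq l).2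
      have e3 : |2 ^ J * ((h q : EuclideanSpace ℝ (Fin d)) - h q') l| ≤ 2 := by
        rw [PiLp.sub_apply, mul_sub]
        exact abs_le.2 ⟨by linarith, by linarith⟩
      rw [abs_mul, abs_of_pos h2J] at e3
      rw [← div_eq_mul_inv, le_div_iff₀ h2J]
      linarith
    have h3 : dist q q' ≤ (d * (2 * (2 ^ J)⁻¹)) / Lmin := by
      rw [le_div_iff₀ hLmin]
      linarith
    refine h3.trans (le_of_eq ?_)
    ring
  · obtain ⟨q₀, hq₀⟩ := hcentre c hc
    refine ⟨q₀, hq₀ q₀ ?_⟩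
    rw [dist_self]
    positivity
  · obtain ⟨q₀, hq₀⟩ := hcentre c hc
    have h1 := le_densityLaw_closedBall hp hball hpmin q₀ (by positivity) hJ
    have h2 : Metric.closedBall q₀ ((4 * Lmax)⁻¹ * (2 ^ J)⁻¹)
        ⊆ (fun q => dyadicCell J (h q : EuclideanSpace ℝ (Fin d))) ⁻¹' {c} :=
      fun q hq => hq₀ q hq
    have h3 := h1.trans (measure_mono h2)
    rw [ENNReal.ofReal_le_iff_le_toReal (measure_ne_top _ _)] at h3
    refine le_trans (le_of_eq ?_) h3
    rw [mul_pow, ← inv_pow _ (J * d), ← inv_pow _ J, pow_mul]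
    ring

end Cells

/-! ### The noise as a functional on signals -/

/-- Suppose every cell contains a sample point, and sample points in the same or in neighbouring
cells are adjacent. Replace a signal by its value at one representative per cell, and write the
resulting grid function through its increments: the noise is then controlled by its maximum, by
its correlations with the columns of the grid kernel, and by its sum. -/
theorem abs_sum_noise_mul_le {n d J : ℕ} (G : SimpleGraph (Fin n)) (κ : Fin n → Fin d → ℕ)
    (hκ : ∀ i, κ i ∈ gridCells d J) (hrep : ∀ c ∈ gridCells d J, ∃ i, κ i = c)
    (hadj : ∀ i j, i ≠ j → (∀ l, κ i l ≤ κ j l + 1 ∧ κ j l ≤ κ i l + 1) → G.Adj i j)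
    (ker : (Fin d → ℕ) → (Fin d → ℕ) × Fin d → ℝ)
    (hker : ∀ u, ∀ c ∈ gridCells d J, u c - ((2 : ℝ) ^ (J * d))⁻¹ * ∑ z ∈ gridCells d J, u z
        = ∑ e ∈ gridEdges d J, ker c e * gridDiff u e)
    (ε : Fin n → ℝ) {τ t s : ℝ} (ht : 0 ≤ t) (hτ : ∀ i, |ε i| ≤ τ)
    (hedge : ∀ e ∈ gridEdges d J, |∑ i, ε i * ker (κ i) e| ≤ t) (hs : |∑ i, ε i| ≤ s)
    (v : Fin n → ℝ) :
    |∑ i, ε i * v i| ≤ s * Real.sqrt (((2 : ℝ) ^ (J * d))⁻¹) * Real.sqrt (∑ i, v i ^ 2)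
      + (2 * τ + 2 * t) * graphTV G v := by
  classical
  have hn : Nonempty (Fin n) := by
    obtain ⟨i, -⟩ := hrep 0 (mem_gridCells.2 fun l => by simp)
    exact ⟨i⟩
  have hτ0 : 0 ≤ τ := (abs_nonneg _).trans (hτ (Classical.arbitrary _))
  have hs0 : 0 ≤ s := (abs_nonneg _).trans hs
  have hr : ∃ rep : (Fin d → ℕ) → Fin n, ∀ c ∈ gridCells d J, κ (rep c) = c :=
    ⟨fun c => if h : c ∈ gridCells d J then (hrep c h).choose else Classical.arbitrary _,
      fun c hc => by simp only [hc, dif_pos]; exact (hrep c hc).choose_spec⟩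
  obtain ⟨rep, hrep'⟩ := hr
  set N : ℝ := 2 ^ (J * d) with hN
  have hN0 : 0 < N := by positivity
  have hNcard : ((gridCells d J).card : ℝ) = N := by rw [card_gridCells, hN]; norm_cast
  set u : (Fin d → ℕ) → ℝ := fun c => v (rep c) with hu
  set m := N⁻¹ * ∑ z ∈ gridCells d J, u z with hm
  have hsplit : ∑ i, ε i * v i = ∑ i, ε i * (v i - v (rep (κ i)))
      + ∑ e ∈ gridEdges d J, (∑ i, ε i * ker (κ i) e) * gridDiff u e + m * ∑ i, ε i := by
    have h1 : ∑ e ∈ gridEdges d J, (∑ i, ε i * ker (κ i) e) * gridDiff u e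
        = ∑ i, ε i * (u (κ i) - m) := by
      simp only [Finset.sum_mul]
      rw [Finset.sum_comm]
      refine Finset.sum_congr rfl fun i _ => ?_
      rw [hm, hker u (κ i) (hκ i), Finset.mul_sum]
      exact Finset.sum_congr rfl fun e _ => by ring
    rw [h1, Finset.mul_sum, ← Finset.sum_add_distrib, ← Finset.sum_add_distrib]
    exact Finset.sum_congr rfl fun i _ => by simp only [hu]; ring
  have hA : |∑ i, ε i * (v i - v (rep (κ i)))| ≤ τ * (2 * graphTV G v) := by
    calc _ ≤ ∑ i, |ε i * (v i - v (rep (κ i)))| := Finset.abs_sum_le_sum_abs _ _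
      _ ≤ ∑ i, τ * |v i - v (rep (κ i))| := Finset.sum_le_sum fun i _ => by
          rw [abs_mul]
          exact mul_le_mul_of_nonneg_right (hτ i) (abs_nonneg _)
      _ ≤ _ := by
          rw [← Finset.mul_sum]
          refine mul_le_mul_of_nonneg_left (sum_abs_sub_le_graphTV G v Finset.univ (fun i => i)
            (fun i => rep (κ i)) ?_ ?_) hτ0
          · intro i _ j _ h
            exact (Prod.ext_iff.1 h).1
          · intro i _ h
            refine hadj _ _ h fun l => ?_
            rw [hrep' _ (hκ i)]
            omega
  have hB : |∑ e ∈ gridEdges d J, (∑ i, ε i * ker (κ i) e) * gridDiff u e|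
      ≤ t * (2 * graphTV G v) := by
    have hmem : ∀ e ∈ gridEdges d J,
        e.1 ∈ gridCells d J ∧ e.1 + Pi.single e.2 1 ∈ gridCells d J := fun e he => by
      obtain ⟨h1, h2⟩ := mem_gridEdges.1 he
      refine ⟨mem_gridCells.2 h1, mem_gridCells.2 fun l => ?_⟩
      by_cases h : l = e.2
      · subst h; simpa using h2
      · simpa [Pi.single_eq_of_ne h] using h1 l
    calc _ ≤ ∑ e ∈ gridEdges d J, |(∑ i, ε i * ker (κ i) e) * gridDiff u e| :=
          Finset.abs_sum_le_sum_abs _ _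
      _ ≤ ∑ e ∈ gridEdges d J, t * |v (rep (e.1 + Pi.single e.2 1)) - v (rep e.1)| :=
          Finset.sum_le_sum fun e he => by
            rw [abs_mul]
            exact mul_le_mul_of_nonneg_right (hedge e he) (abs_nonneg _)
      _ ≤ _ := by
          rw [← Finset.mul_sum]
          refine mul_le_mul_of_nonneg_left (sum_abs_sub_le_graphTV G v (gridEdges d J)
            (fun e => rep (e.1 + Pi.single e.2 1)) (fun e => rep e.1) ?_ ?_) ht
          · intro e he e' he' h
            obtain ⟨h1, h2⟩ := Prod.ext_iff.1 h
            have g1 := congrArg κ h1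
            have g2 := congrArg κ h2
            simp only at g1 g2
            rw [hrep' _ (hmem e he).2, hrep' _ (hmem e' he').2] at g1
            rw [hrep' _ (hmem e he).1, hrep' _ (hmem e' he').1] at g2
            rw [g2] at g1
            have g3 := add_left_cancel g1
            refine Prod.ext g2 ?_
            by_contra hne
            have := congrFun g3 e.2
            simp [Pi.single_eq_of_ne hne] at this
          · intro e he h
            refine hadj _ _ h fun l => ?_
            rw [hrep' _ (hmem e he).1, hrep' _ (hmem e he).2]
            by_cases h : l = e.2
            · subst h
              simp
              omega
            · simp [Pi.single_eq_of_ne h]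
  have hC : |m * ∑ i, ε i| ≤ s * Real.sqrt N⁻¹ * Real.sqrt (∑ i, v i ^ 2) := by
    have h1 : m ^ 2 ≤ N⁻¹ * ∑ i, v i ^ 2 := by
      have h2 := sq_sum_le_card_mul_sum_sq (s := gridCells d J) (f := u)
      rw [hNcard] at h2
      have h3 : ∑ c ∈ gridCells d J, u c ^ 2 ≤ ∑ i, v i ^ 2 := by
        have hinj : Set.InjOn rep (gridCells d J) := fun c hc c' hc' h => by
          rw [← hrep' c hc, ← hrep' c' hc', h]
        simp only [hu]
        rw [← Finset.sum_image (f := fun i => v i ^ 2) hinj]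
        exact Finset.sum_le_sum_of_subset_of_nonneg (Finset.subset_univ _)
          fun _ _ _ => sq_nonneg _
      calc m ^ 2 = N⁻¹ ^ 2 * (∑ z ∈ gridCells d J, u z) ^ 2 := by rw [hm]; ring
        _ ≤ N⁻¹ ^ 2 * (N * ∑ i, v i ^ 2) := by gcongr; exact h2.trans (by gcongr)
        _ = N⁻¹ * ∑ i, v i ^ 2 := by field_simp
    have h4 : |m| ≤ Real.sqrt N⁻¹ * Real.sqrt (∑ i, v i ^ 2) := by
      rw [← Real.sqrt_mul (by positivity)]
      exact Real.abs_le_sqrt h1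
    rw [abs_mul, mul_comm, mul_assoc]
    exact mul_le_mul hs h4 (abs_nonneg _) hs0
  rw [hsplit]
  refine (abs_add_le _ _).trans ((add_le_add_left (abs_add_le _ _) _).trans ?_)
  linarith

/-! ### The prediction error at a fixed sample size -/

section FixedSampleSize

variable {Ω : Type v} [MeasurableSpace Ω] {P : Measure Ω}

theorem measure_exists_mem_le {ι : Type*} (S : Finset ι) (Q : ι → Ω → Prop) {q N : ℝ}
    (hq : 0 ≤ q) (hN : (S.card : ℝ) ≤ N) (h : ∀ c ∈ S, P {ω | Q c ω} ≤ ENNReal.ofReal q) :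
    P {ω | ∃ c ∈ S, Q c ω} ≤ ENNReal.ofReal (N * q) := by
  calc P {ω | ∃ c ∈ S, Q c ω} ≤ P (⋃ c ∈ S, {ω | Q c ω}) :=
        measure_mono fun ω ⟨c, hc, hω⟩ => Set.mem_biUnion hc hω
    _ ≤ ∑ c ∈ S, P {ω | Q c ω} := measure_biUnion_finset_le _ _
    _ ≤ ∑ _c ∈ S, ENNReal.ofReal q := Finset.sum_le_sum h
    _ = ENNReal.ofReal (S.card * q) := by
        rw [Finset.sum_const, nsmul_eq_mul, ENNReal.ofReal_mul (Nat.cast_nonneg _),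
          ENNReal.ofReal_natCast]
    _ ≤ _ := ENNReal.ofReal_le_ofReal (mul_le_mul_of_nonneg_right hN hq)

/-- If every cell holds at most `K` of the points, the correlations of the noise with the columns
of the grid kernel are sub-Gaussian of variance `O(K J)`. -/
theorem measure_exists_edge_noise_ge_le {n d J K : ℕ} (κ : Fin n → Fin d → ℕ)
    (hκ : ∀ i, κ i ∈ gridCells d J)
    (hcard : ∀ c ∈ gridCells d J, (Finset.univ.filter fun i => κ i = c).card ≤ K)
    (ker : (Fin d → ℕ) → (Fin d → ℕ) × Fin d → ℝ)
    (hker : ∀ e, ∑ c ∈ gridCells d J, ker c e ^ 2 ≤ 3 * 2 ^ d * J)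
    {ε : Fin n → Ω → ℝ} (hind : iIndepFun ε P) {c : ℝ} (hc : 0 < c) (hK : 0 < K)
    (hsub : ∀ i, HasSubgaussianMGF (ε i) c.toNNReal P) {t l : ℝ} (ht : 0 ≤ t)
    (htl : 4 * (c * (K * (3 * 2 ^ d * (J + 1)))) * l ≤ t ^ 2) :
    P {ω | ∃ e ∈ gridEdges d J, t ≤ |∑ i, ε i ω * ker (κ i) e|}
      ≤ ENNReal.ofReal (d * 2 ^ (J * d) * (2 * Real.exp (-2 * l))) := by
  have hV : (0 : ℝ) < K * (3 * 2 ^ d * (J + 1)) := by positivity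
  refine measure_exists_mem_le _ _ (by positivity)
    (by exact_mod_cast card_gridEdges_le d J) fun e _ => ?_
  refine (measure_abs_weighted_sum_ge_le hind hc hsub (fun i => ker (κ i) e) hV ?_ ht).trans
    (ENNReal.ofReal_le_ofReal ?_)
  · calc ∑ i, ker (κ i) e ^ 2
        = ∑ z ∈ gridCells d J, ∑ i ∈ Finset.univ.filter (fun i => κ i = z), ker (κ i) e ^ 2 :=
          (Finset.sum_fiberwise_of_maps_to (fun i _ => hκ i) _).symm
      _ = ∑ z ∈ gridCells d J,
            ((Finset.univ.filter fun i => κ i = z).card : ℝ) * ker z e ^ 2 := by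
          refine Finset.sum_congr rfl fun z _ => ?_
          rw [Finset.sum_congr rfl (g := fun _ => ker z e ^ 2)
            (fun i hi => by rw [(Finset.mem_filter.1 hi).2]), Finset.sum_const, nsmul_eq_mul]
      _ ≤ ∑ z ∈ gridCells d J, (K : ℝ) * ker z e ^ 2 := Finset.sum_le_sum fun z hz =>
          mul_le_mul_of_nonneg_right (Nat.cast_le.2 (hcard z hz)) (sq_nonneg _)
      _ ≤ K * (3 * 2 ^ d * (J + 1)) := by
          rw [← Finset.mul_sum]
          refine mul_le_mul_of_nonneg_left ((hker e).trans ?_) (by positivity)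
          gcongr
          linarith
  · gcongr
    rw [div_le_iff₀ (by positivity)]
    linarith

variable {X : Type u} [MetricSpace X] [MeasurableSpace X] [BorelSpace X]

open Classical in
/-- The main estimate, for a sample of fixed size `n`, a fine grid of side `2 ^ J` whose cells have
expected count a small multiple of `K`, and a coarse grid of side `2 ^ J'` whose cells have
expected count a large multiple of `K`. The fine grid serves the estimation error at the sample
points, the coarse one the passage to new points. -/
theorem measure_predictionError_gt_le [IsProbabilityMeasure P] {d : ℕ} (hd : 2 ≤ d)
    {pmin pmax r₀ c₁ c₂ Lmin Lmax C σ : ℝ} {μ : Measure X} {p f₀ : X → ℝ}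
    (hp : IsBoundedDensity μ p pmin pmax) (hball : HasBallVolume μ d r₀ c₁ c₂)
    (hX : IsBilipschitzCube X d Lmin Lmax) (hpmin : 0 < pmin) (hpmax : 0 < pmax)
    (hc₂ : 0 < c₂) (hLmin : 0 < Lmin) (hLmax : 0 < Lmax) (hC : 0 < C)
    (hσ : 0 < σ) {n : ℕ} (hn : 0 < n) {x : Fin n → Ω → X} {ε : Fin n → Ω → ℝ}
    (hS : IsRegressionSample P (densityLaw μ p) C σ x ε)
    {K J J' : ℕ} (hKn : K ≤ n) (hK : 4 * Real.log n ≤ K) (hK0 : 0 < K)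
    (hJn : 2 ^ (J * d) ≤ n) (hJn' : 2 ^ (J' * d) ≤ n)
    (hr : (4 * Lmax)⁻¹ * (2 ^ J)⁻¹ < r₀) (hr' : (4 * Lmax)⁻¹ * (2 ^ J')⁻¹ < r₀)
    (hρ : 2 * (2 * d / Lmin * (2 ^ J)⁻¹) < r₀) (hρ' : 2 * d / Lmin * (2 ^ J')⁻¹ < r₀)
    (hup : n * (pmax * (c₂ * (2 * (2 * d / Lmin * (2 ^ J)⁻¹)) ^ d)) ≤ K / 4)
    (hlow : 8 * Real.log n ≤ n * (pmin * c₁ * (4 * Lmax)⁻¹ ^ d * (2 ^ (J * d))⁻¹))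
    (hlow' : 4 * K ≤ n * (pmin * c₁ * (4 * Lmax)⁻¹ ^ d * (2 ^ (J' * d))⁻¹))
    {τ t t₀ lam : ℝ} (hτ : 0 < τ) (ht : 0 ≤ t) (ht₀ : 0 ≤ t₀)
    (hτ' : 4 * σ ^ 2 * Real.log n ≤ τ ^ 2)
    (ht' : 4 * (8 * (C + 1) * σ ^ 2 * (K * (3 * 2 ^ d * (J + 1)))) * Real.log n ≤ t ^ 2)
    (hlam : 2 * τ + 2 * t ≤ lam) :
    P {ω | 2 * approxError (densityLaw μ p) f₀ (fun i => x i ω) K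
          + ENNReal.ofReal (2 * (pmax * (c₂ * (2 * d / Lmin * (2 ^ J')⁻¹) ^ d)) / K *
            (4 * (t₀ ^ 2 * n * (2 ^ (J * d))⁻¹) + 8 * lam *
              graphTV (knnGraph (fun i => x i ω) K) (fun i => f₀ (x i ω))))
        < integratedSqError (densityLaw μ p) f₀ (knnPredict (fun i => x i ω) K
            (knnFusedLasso (fun i => x i ω) K lam (fun i => f₀ (x i ω) + ε i ω)))}
      ≤ ENNReal.ofReal ((3 + C + 2 * d) / n
          + 2 * Real.exp (-t₀ ^ 2 / (2 * (8 * (C + 1) * σ ^ 2)))) := by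
  set ν := densityLaw μ p with hν
  have hνP : IsProbabilityMeasure ν := isProbabilityMeasure_densityLaw hp
  have hn' : (0 : ℝ) < n := by exact_mod_cast hn
  have hd0 : (0 : ℝ) < d := by exact_mod_cast (by omega : 0 < d)
  set ρ := 2 * d / Lmin * ((2 : ℝ) ^ J)⁻¹ with hρdef
  set ρ' := 2 * d / Lmin * ((2 : ℝ) ^ J')⁻¹ with hρ'def
  have hρ0 : 0 < ρ := by positivity
  have hρ0' : 0 < ρ' := by positivity
  have hexp2 : Real.exp (-2 * Real.log n) = ((n : ℝ) ^ 2)⁻¹ := by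
    rw [neg_mul, Real.exp_neg, two_mul, Real.exp_add, Real.exp_log hn', sq]
  have hnexp : (n : ℝ) * Real.exp (-2 * Real.log n) = 1 / n := by
    rw [hexp2]; field_simp
  obtain ⟨cell, hcm, hcmem, hcdist, hcne, hcmass⟩ :=
    exists_cellMap hp hball hpmin.le hLmin hLmax hX J hr
  obtain ⟨cell', hcm', hcmem', hcdist', -, hcmass'⟩ :=
    exists_cellMap hp hball hpmin.le hLmin hLmax hX J' hr'
  have hXne : Nonempty X := (hcne 0 (mem_gridCells.2 fun l => by simp)).nonempty
  choose! ctr hctr using hcne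
  obtain ⟨ker, hker, hkersq⟩ := exists_gridKernel hd J
  have hsub : ∀ i, HasSubgaussianMGF (ε i) (8 * (C + 1) * σ ^ 2).toNNReal P := fun i =>
    hasSubgaussianMGF_of_tail (hS.measurable_noise i) hC hσ (hS.mean_noise i) (hS.tail_noise i)
  have hc0 : 0 < 8 * (C + 1) * σ ^ 2 := by positivity
  have hball_real : ∀ q s, 0 < s → s < r₀ →
      ν.real (Metric.closedBall q s) ≤ pmax * (c₂ * s ^ d) := fun q s h0 h1 =>
    ENNReal.toReal_le_of_le_ofReal (by positivity)
      (densityLaw_closedBall_le hp hball hpmax.le q h0 h1)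
  have hcells : ∀ j : ℕ, 2 ^ (j * d) ≤ n → ((gridCells d j).card : ℝ) ≤ n := fun j hj => by
    rw [card_gridCells]
    exact_mod_cast hj
  have hfib : ∀ c, MeasurableSet (cell ⁻¹' {c}) := fun c => hcm (measurableSet_singleton c)
  have hfib' : ∀ c, MeasurableSet (cell' ⁻¹' {c}) := fun c => hcm' (measurableSet_singleton c)
  -- the exceptional events
  -- (an empty fine cell, a crowded ball, a sparse coarse cell, large errors, a large sum of errors,
  -- and large correlations with the kernel, the latter for admissible cell assignments only)
  set B₁ : Set Ω := {ω | ∃ c ∈ gridCells d J,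
    (Finset.univ.filter fun i => x i ω ∈ cell ⁻¹' {c}).card ≤ 0} with hB₁
  set B₂ : Set Ω := {ω | ∃ c ∈ gridCells d J,
    K ≤ (Finset.univ.filter fun i => x i ω ∈ Metric.closedBall (ctr c) (2 * ρ)).card} with hB₂
  set B₃ : Set Ω := {ω | ∃ c ∈ gridCells d J',
    (Finset.univ.filter fun i => x i ω ∈ cell' ⁻¹' {c}).card ≤ K} with hB₃
  set B₄ : Set Ω := {ω | ∃ i ∈ (Finset.univ : Finset (Fin n)), τ < |ε i ω|} with hB₄
  set B₅ : Set Ω := {ω | t₀ * Real.sqrt n ≤ |∑ i, ε i ω * 1|} with hB₅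
  set good : Set (Fin n → Fin d → ℕ) := {κ | (∀ i, κ i ∈ gridCells d J) ∧
    ∀ c ∈ gridCells d J, (Finset.univ.filter fun i => κ i = c).card ≤ K} with hgood
  set E : (Fin n → Fin d → ℕ) → Set (Fin n → ℝ) := fun κ =>
    {w | ∃ e ∈ gridEdges d J, t ≤ |∑ i, w i * ker (κ i) e|} with hE
  set B₆ : Set Ω := {ω | (fun i => cell (x i ω)) ∈ good ∧
    (fun i => ε i ω) ∈ E (fun i => cell (x i ω))} with hB₆
  have hP₁ : P B₁ ≤ ENNReal.ofReal (1 / n) := by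
    rw [← hnexp]
    refine measure_exists_mem_le _ _ (Real.exp_pos _).le (hcells J hJn) fun c hc => ?_
    have hm := mul_le_mul_of_nonneg_left (hcmass c hc) hn'.le
    refine (measure_count_le_le (hfib c) hS.measurable_x hS.law_x hS.indep_x (k := 0) ?_).trans
      (ENNReal.ofReal_le_ofReal (Real.exp_le_exp.2 ?_))
    · simp only [CharP.cast_eq_zero, mul_zero]
      positivity
    · linarith
  have hP₂ : P B₂ ≤ ENNReal.ofReal (1 / n) := by
    rw [← hnexp]
    refine measure_exists_mem_le _ _ (Real.exp_pos _).le (hcells J hJn) fun c hc => ?_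
    have hm := mul_le_mul_of_nonneg_left (hball_real (ctr c) (2 * ρ) (by positivity) hρ) hn'.le
    refine (measure_le_count_le Metric.isClosed_closedBall.measurableSet hS.measurable_x hS.law_x
      hS.indep_x (hm.trans hup)).trans (ENNReal.ofReal_le_ofReal (Real.exp_le_exp.2 ?_))
    linarith
  have hP₃ : P B₃ ≤ ENNReal.ofReal (1 / n) := by
    rw [← hnexp]
    refine measure_exists_mem_le _ _ (Real.exp_pos _).le (hcells J' hJn') fun c hc => ?_
    have hm := mul_le_mul_of_nonneg_left (hcmass' c hc) hn'.le
    refine (measure_count_le_le (hfib' c) hS.measurable_x hS.law_x hS.indep_x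
      (hlow'.trans hm)).trans (ENNReal.ofReal_le_ofReal (Real.exp_le_exp.2 ?_))
    have hlogn : 0 ≤ Real.log n := Real.log_natCast_nonneg n
    linarith
  have hP₄ : P B₄ ≤ ENNReal.ofReal (C * (1 / n)) := by
    rw [← hnexp, mul_left_comm]
    refine measure_exists_mem_le _ _ (by positivity) (by simp) fun i _ => ?_
    refine (hS.tail_noise i τ hτ).trans (ENNReal.ofReal_le_ofReal ?_)
    gcongr
    rw [div_le_iff₀ (by positivity)]
    linarith
  have hP₅ : P B₅ ≤ ENNReal.ofReal (2 * Real.exp (-t₀ ^ 2 / (2 * (8 * (C + 1) * σ ^ 2)))) := by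
    refine (measure_abs_weighted_sum_ge_le hS.indep_noise hc0 hsub (fun _ => 1) hn' (by simp)
      (by positivity)).trans (ENNReal.ofReal_le_ofReal (le_of_eq ?_))
    rw [mul_pow, Real.sq_sqrt hn'.le]
    congr 2
    field_simp
  have hP₆ : P B₆ ≤ ENNReal.ofReal (2 * d * (1 / n)) := by
    have hκm : Measurable fun ω i => cell (x i ω) :=
      measurable_pi_lambda _ fun i => hcm.comp (hS.measurable_x i)
    have hκind : IndepFun (fun ω i => cell (x i ω)) (fun ω i => ε i ω) P :=
      hS.indep_x_noise.comp (φ := fun z : Fin n → X => fun i => cell (z i)) (ψ := id)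
        (measurable_pi_lambda _ fun i => hcm.comp (measurable_pi_apply i)) measurable_id
    refine measure_inter_le_of_indepFun hκm hκind good E (fun κ => ?_) fun κ hκ => ?_
    · have : E κ = ⋃ e ∈ gridEdges d J, {w | t ≤ |∑ i, w i * ker (κ i) e|} := by
        ext w
        simp [hE]
      rw [this]
      refine Finset.measurableSet_biUnion _ fun e _ => measurableSet_le measurable_const ?_
      fun_prop
    · refine (measure_exists_edge_noise_ge_le κ hκ.1 hκ.2 ker hkersq hS.indep_noise hc0 hK0 hsub
        ht ht').trans (ENNReal.ofReal_le_ofReal ?_)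
      have hJn2 : (2 : ℝ) ^ (J * d) ≤ n := by exact_mod_cast hJn
      calc (d : ℝ) * 2 ^ (J * d) * (2 * Real.exp (-2 * Real.log n))
          ≤ d * n * (2 * Real.exp (-2 * Real.log n)) := by gcongr
        _ = 2 * d * (n * Real.exp (-2 * Real.log n)) := by ring
        _ = _ := by rw [hnexp]
  have hunion : P (B₁ ∪ (B₂ ∪ (B₃ ∪ (B₄ ∪ (B₅ ∪ B₆))))) ≤ ENNReal.ofReal ((3 + C + 2 * d) / n
      + 2 * Real.exp (-t₀ ^ 2 / (2 * (8 * (C + 1) * σ ^ 2)))) := by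
    have hsum : (3 + C + 2 * d) / n + 2 * Real.exp (-t₀ ^ 2 / (2 * (8 * (C + 1) * σ ^ 2)))
        = 1 / n + (1 / n + (1 / n + (C * (1 / n)
          + (2 * Real.exp (-t₀ ^ 2 / (2 * (8 * (C + 1) * σ ^ 2))) + 2 * d * (1 / n))))) := by
      field_simp
      ring
    rw [hsum, ENNReal.ofReal_add (by positivity) (by positivity),
      ENNReal.ofReal_add (by positivity) (by positivity),
      ENNReal.ofReal_add (by positivity) (by positivity),
      ENNReal.ofReal_add (by positivity) (by positivity),
      ENNReal.ofReal_add (by positivity) (by positivity)]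
    exact (measure_union_le _ _).trans (add_le_add hP₁ ((measure_union_le _ _).trans
      (add_le_add hP₂ ((measure_union_le _ _).trans (add_le_add hP₃ ((measure_union_le _ _).trans
      (add_le_add hP₄ ((measure_union_le _ _).trans (add_le_add hP₅ hP₆)))))))))
  refine (measure_mono fun ω hω => ?_).trans hunion
  by_contra hbad
  simp only [Set.mem_union, not_or] at hbad
  obtain ⟨h₁, h₂, h₃, h₄, h₅, h₆⟩ := hbad
  rw [Set.mem_ofPred_eq] at hω
  refine absurd hω (not_lt.2 ?_)
  -- on the complement, the deterministic estimates apply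
  set z : Fin n → X := fun i => x i ω with hz
  have hsame : ∀ q c, cell q = c → c ∈ gridCells d J → dist q (ctr c) ≤ ρ := fun q c hq hc =>
    hcdist q (ctr c) fun l => by rw [hq, hctr c hc]; omega
  have hcount : ∀ c ∈ gridCells d J,
      (Finset.univ.filter fun i => z i ∈ Metric.closedBall (ctr c) (2 * ρ)).card ≤ K :=
    fun c hc => by
      by_contra! hlt
      exact h₂ ⟨c, hc, hlt.le⟩
  have hgoodω : (fun i => cell (z i)) ∈ good := by
    refine ⟨fun i => hcmem _, fun c hc => (Finset.card_le_card fun i hi => ?_).trans (hcount c hc)⟩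
    refine Finset.mem_filter.2 ⟨Finset.mem_univ _, Metric.mem_closedBall.2 ?_⟩
    have := hsame (z i) c (Finset.mem_filter.1 hi).2 hc
    linarith
  have hadj : ∀ i j, i ≠ j →
      (∀ l, cell (z i) l ≤ cell (z j) l + 1 ∧ cell (z j) l ≤ cell (z i) l + 1) →
      (knnGraph z K).Adj i j := fun i j hij hl => by
    -- the ball of radius `ρ` around `z j` lies in the ball of radius `2 ρ` around a point of the
    -- cell of `z j`
    refine knnGraph_adj_of_dist_le z hij (hcdist _ _ hl) _ (fun k hk => ?_)
      (hcount (cell (z j)) (hcmem _))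
    refine Finset.mem_filter.2 ⟨Finset.mem_univ _, Metric.mem_closedBall.2 ?_⟩
    have := hsame (z j) _ rfl (hcmem _)
    linarith [dist_triangle (z k) (z j) (ctr (cell (z j)))]
  have hrep : ∀ c ∈ gridCells d J, ∃ i, cell (z i) = c := fun c hc => by
    by_contra! hne
    refine h₁ ⟨c, hc, (Finset.card_eq_zero.2 (Finset.filter_eq_empty_iff.2 fun i _ => ?_)).le⟩
    exact hne i
  have hnoise := abs_sum_noise_mul_le (knnGraph z K) (fun i => cell (z i)) (fun i => hcmem _)
    hrep hadj ker hker (fun i => ε i ω) (τ := τ) (t := t) (s := t₀ * Real.sqrt n) ht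
    (fun i => by
      by_contra! hlt
      exact h₄ ⟨i, Finset.mem_univ _, hlt⟩)
    (fun e he => by
      by_contra! hlt
      exact h₆ ⟨hgoodω, e, he, hlt.le⟩)
    (by
      by_contra! hlt
      refine h₅ ?_
      change _ ≤ |∑ i, ε i ω * 1|
      simpa using hlt.le)
  have hlam0 : 0 ≤ lam := by linarith
  have hest := fusedLasso_sq_error_le (knnGraph z K) hlam0 (fun i => f₀ (z i)) (fun i => ε i ω)
    (A := t₀ * Real.sqrt n * Real.sqrt (((2 : ℝ) ^ (J * d))⁻¹)) fun v =>
      (hnoise v).trans (add_le_add le_rfl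
        (mul_le_mul_of_nonneg_right hlam (graphTV_nonneg _ _)))
  rw [mul_pow, mul_pow, Real.sq_sqrt hn'.le, Real.sq_sqrt (by positivity)] at hest
  have hnear : ∀ q, ∀ i ∈ nearestNeighbors z K q, dist (z i) q ≤ ρ' := fun q i hi => by
    refine dist_le_of_mem_nearestNeighbors z
      (Finset.univ.filter fun k => z k ∈ cell' ⁻¹' {cell' q}) (fun k hk => ?_) ?_ hi
    · refine hcdist' _ _ fun l => ?_
      have : cell' (z k) = cell' q := (Finset.mem_filter.1 hk).2
      rw [this]
      omega
    · by_contra! hlt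
      exact h₃ ⟨cell' q, hcmem' q, hlt.le⟩
  refine (integratedSqError_knnPredict_le ν f₀ z hK0 hKn _ (ρ := ρ')
    (V := pmax * (c₂ * ρ' ^ d)) (by positivity) hnear fun i =>
      densityLaw_closedBall_le hp hball hpmax.le _ hρ0' hρ').trans ?_
  refine add_le_add le_rfl (ENNReal.ofReal_le_ofReal ?_)
  exact mul_le_mul_of_nonneg_left hest (by positivity)

end FixedSampleSize

/-! ### Choice of the tuning parameters -/

/-- A dyadic grid whose cells have expected count of order `a * K`, and which is as fine as desired
if `n / K` is large. -/
theorem exists_gridSide {d : ℕ} {a k m η : ℝ} (ha : 0 < a) (hk : 0 < k) (hη : 0 < η) (hd : d ≠ 0)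
    (h1 : a * k ≤ m) (h2 : a * k * (2 / η) ^ d ≤ m) :
    ∃ J : ℕ, a * k * 2 ^ (J * d) ≤ m ∧ m ≤ a * k * 2 ^ d * 2 ^ (J * d) ∧ ((2 : ℝ) ^ J)⁻¹ < η := by
  have hak : 0 < a * k := by positivity
  obtain ⟨J, hJ1, hJ2⟩ := exists_nat_pow_near (x := m / (a * k)) (y := (2 : ℝ) ^ d)
    ((one_le_div hak).2 h1) (one_lt_pow₀ one_lt_two hd)
  rw [← pow_mul, mul_comm d] at hJ1 hJ2
  rw [le_div_iff₀ hak] at hJ1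
  have hJ3 := (div_lt_iff₀ hak).1 hJ2
  refine ⟨J, by linarith, ?_, ?_⟩
  · rw [add_mul, pow_add, one_mul] at hJ3
    linarith
  · have h3 : (2 / η) ^ d < (2 ^ (J + 1)) ^ d := by
      rw [← pow_mul]
      refine lt_of_le_of_lt ?_ hJ2
      rw [le_div_iff₀ hak]
      linarith
    have h4 := lt_of_pow_lt_pow_left₀ d (by positivity) h3
    rw [div_lt_iff₀ hη, pow_succ] at h4
    rw [inv_lt_iff_one_lt_mul₀ (by positivity)]
    linarith

theorem eventually_mul_log_le {r : ℝ} (hr : 0 < r) {K : ℕ → ℕ}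
    (hK : (fun n : ℕ => Real.log n ^ (1 + 2 * r)) =O[atTop] fun n : ℕ => (K n : ℝ)) (A : ℝ) :
    ∀ᶠ n : ℕ in atTop, A * Real.log n ≤ K n := by
  obtain ⟨b, hb0, hb⟩ := hK.exists_pos
  have hlog : Tendsto (fun n : ℕ => Real.log n) atTop atTop :=
    Real.tendsto_log_atTop.comp tendsto_natCast_atTop_atTop
  have hpow : Tendsto (fun n : ℕ => Real.log n ^ (2 * r)) atTop atTop :=
    (tendsto_rpow_atTop (by positivity)).comp hlog
  filter_upwards [hb.bound, hlog.eventually_ge_atTop 1, hpow.eventually_ge_atTop (b * A)]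
    with n h1 h2 h3
  rw [Real.norm_of_nonneg (by positivity), Real.norm_of_nonneg (by positivity),
    Real.rpow_add (by positivity), Real.rpow_one] at h1
  have h4 : b * (A * Real.log n) ≤ b * K n := by nlinarith
  exact le_of_mul_le_mul_left h4 hb0

theorem eventually_mul_le_natCast {r : ℝ} {K : ℕ → ℕ}
    (hK : (fun n : ℕ => (K n : ℝ)) =O[atTop] fun n : ℕ => Real.log n ^ (1 + 2 * r)) {A : ℝ}
    (hA : 0 < A) : ∀ᶠ n : ℕ in atTop, A * K n ≤ n := by
  have h1 : (fun n : ℕ => Real.log n ^ (1 + 2 * r)) =o[atTop] fun n : ℕ => (n : ℝ) := by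
    have h := (isLittleO_log_rpow_rpow_atTop (1 + 2 * r) zero_lt_one).comp_tendsto
      tendsto_natCast_atTop_atTop
    simpa [Function.comp_def] using h
  filter_upwards [(hK.trans_isLittleO h1).bound (inv_pos.2 hA)] with n h2
  rw [Real.norm_of_nonneg (by positivity), Real.norm_of_nonneg (by positivity),
    ← div_eq_inv_mul, le_div_iff₀ hA] at h2
  linarith

theorem natCast_add_one_le_two_mul_log {d J n : ℕ} (hd : 2 ≤ d) (hn : 1 ≤ Real.log n)
    (hJ : 2 ^ (J * d) ≤ n) : (J : ℝ) + 1 ≤ 2 * Real.log n := by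
  have h1 : Real.log ((2 : ℝ) ^ (J * d)) ≤ Real.log n :=
    Real.log_le_log (by positivity) (by exact_mod_cast hJ)
  rw [Real.log_pow] at h1
  push_cast at h1
  have h2 := Real.log_two_gt_d9
  have h3 : (2 : ℝ) ≤ d := by exact_mod_cast hd
  have h4 : (J : ℝ) * 1 ≤ J * d * Real.log 2 := by
    rw [mul_assoc]
    refine mul_le_mul_of_nonneg_left ?_ (Nat.cast_nonneg J)
    nlinarith
  linarith

theorem two_mul_exp_neg_sq_div_le {c δ : ℝ} (hc : 0 < c) (hδ : 0 < δ) :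
    2 * Real.exp (-Real.sqrt (2 * c * |Real.log (4 / δ)|) ^ 2 / (2 * c)) ≤ δ / 2 := by
  rw [Real.sq_sqrt (by positivity)]
  have h1 : -(2 * c * |Real.log (4 / δ)|) / (2 * c) = -|Real.log (4 / δ)| := by field_simp
  have h2 : Real.exp (-|Real.log (4 / δ)|) ≤ Real.exp (-Real.log (4 / δ)) :=
    Real.exp_le_exp.2 (neg_le_neg (le_abs_self _))
  rw [Real.exp_neg (Real.log _), Real.exp_log (by positivity)] at h2
  rw [h1]
  have h3 : (4 / δ)⁻¹ = δ / 4 := by rw [inv_div]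
  linarith

theorem prediction_rate_le {v c Λ Q R V n W D : ℝ} (hv : 0 ≤ v) (hc : 0 ≤ c) (hΛ : 0 ≤ Λ)
    (hQ : 0 ≤ Q) (hR : 0 ≤ R) (hV : 0 ≤ V) (hn : 0 < n) (hW : W ≤ 2 * v / n)
    (hD : D ≤ c * R) (hD0 : 0 ≤ D) :
    W * (4 * D + 8 * (Λ * Q) * V) ≤ (2 + 2 * v * (4 * c + 8 * Λ)) * (R / n + Q / n * V) := by
  have h1 : 0 ≤ R / n := by positivity
  have h2 : 0 ≤ Q / n * V := by positivity
  have h3 : 0 ≤ v * c := mul_nonneg hv hc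
  have h4 : 0 ≤ v * Λ := mul_nonneg hv hΛ
  calc W * (4 * D + 8 * (Λ * Q) * V) ≤ 2 * v / n * (4 * (c * R) + 8 * (Λ * Q) * V) := by gcongr
    _ = 8 * (v * c) * (R / n) + 16 * (v * Λ) * (Q / n * V) := by ring
    _ ≤ (2 + 8 * (v * c) + 16 * (v * Λ)) * (R / n)
        + (2 + 8 * (v * c) + 16 * (v * Λ)) * (Q / n * V) := by
        gcongr <;> linarith
    _ = _ := by ring

end

theorem theorem5p1
    (d : ℕ) (hd : 2 ≤ d)
    (pmin pmax r₀ c₁ c₂ Lmin Lmax C σ r : ℝ)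
    (hpmin : 0 < pmin) (hr₀ : 0 < r₀) (hc₁ : 0 < c₁) (hc₂ : 0 < c₂)
    (hLmin : 0 < Lmin) (hLmax : 0 < Lmax) (hC : 0 < C) (hσ : 0 < σ) (hr : 0 < r)
    (K : ℕ → ℕ)
    (hK : (fun n : ℕ => (K n : ℝ)) =Θ[atTop] fun n : ℕ => Real.log n ^ (1 + 2 * r)) :
    ∃ lam : ℕ → ℝ, (∀ n, 0 < lam n) ∧
      ∀ δ : ℝ, 0 < δ → ∃ M : ℝ, 0 < M ∧ ∃ n₀ : ℕ, ∀ n : ℕ, n₀ ≤ n →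
        ∀ (X : Type u) [MetricSpace X] [MeasurableSpace X] [BorelSpace X]
          (μ : Measure X) (p f₀ : X → ℝ)
          (Ω : Type v) [MeasurableSpace Ω] (P : Measure Ω) [IsProbabilityMeasure P]
          (x : Fin n → Ω → X) (ε : Fin n → Ω → ℝ),
          IsBoundedDensity μ p pmin pmax →
          HasBallVolume μ d r₀ c₁ c₂ →
          IsBilipschitzCube X d Lmin Lmax →
          Measurable f₀ →
          IsRegressionSample P (densityLaw μ p) C σ x ε →
          P {ω |
              ENNReal.ofReal M *
                (ENNReal.ofReal
                    (Real.log n ^ (1 + 2 * r) / n +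
                      Real.log n ^ (3 / 2 + r) / n *
                        graphTV (knnGraph (fun i => x i ω) (K n)) (fun i => f₀ (x i ω))) +
                  approxError (densityLaw μ p) f₀ (fun i => x i ω) (K n)) <
                integratedSqError (densityLaw μ p) f₀
                  (knnPredict (fun i => x i ω) (K n)
                    (knnFusedLasso (fun i => x i ω) (K n) (lam n)
                      (fun i => f₀ (x i ω) + ε i ω)))}
            ≤ ENNReal.ofReal δ := by
  obtain ⟨b, hb0, hb⟩ := hK.1.exists_pos
  have hd0 : (0 : ℝ) < d := by exact_mod_cast (by omega : 0 < d)
  set c : ℝ := 8 * (C + 1) * σ ^ 2 with hc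
  have hc0 : 0 < c := by positivity
  -- `pmax` is only positive because the model is inhabited, so it is replaced by `max pmax 1`
  set pM : ℝ := max pmax 1 with hpM
  have hpM0 : 0 < pM := zero_lt_one.trans_le (le_max_right _ _)
  set α : ℝ := pmin * c₁ * (4 * Lmax)⁻¹ ^ d with hα
  have hα0 : 0 < α := by positivity
  set β : ℝ := pM * c₂ * (4 * d / Lmin) ^ d with hβ
  have hβ0 : 0 < β := by positivity
  -- `n 2 ^ (-J d)` is at most `2 ^ d a K` on the fine grid, at least `a' K` on the coarse one
  set a : ℝ := 1 / (4 * 2 ^ d * β) with ha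
  have ha0 : 0 < a := by positivity
  set a' : ℝ := 4 / α with ha'
  have ha0' : 0 < a' := by positivity
  -- cells of side below `η` fit into balls of radius below `r₀`, where the volume bounds hold
  set η : ℝ := min (4 * Lmax * r₀) (r₀ * Lmin / (4 * d)) with hη
  have hη0 : 0 < η := by positivity
  -- `T log ^ (3 / 2 + r) n` bounds the correlations of the noise with the kernel columns
  set T : ℝ := Real.sqrt (24 * c * b * 2 ^ d) with hT
  set Λ : ℝ := 4 * σ + 2 * T with hΛ
  have hΛ0 : 0 < Λ := by positivity
  have hlog : Tendsto (fun n : ℕ => Real.log n) atTop atTop :=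
    Real.tendsto_log_atTop.comp tendsto_natCast_atTop_atTop
  refine ⟨fun n => if 1 ≤ Real.log n then Λ * Real.log n ^ (3 / 2 + r) else 1, fun n => ?_,
    fun δ hδ => ?_⟩
  · dsimp only
    split_ifs with h
    · have : 0 < Real.log n := by linarith
      positivity
    · exact one_pos
  -- `|∑ i, ε i|` exceeds `t₀ √n` with probability at most `δ / 2`; all else is `O(1 / n)`
  set t₀ : ℝ := Real.sqrt (2 * c * |Real.log (4 / δ)|) with ht₀
  have ht₀0 : 0 ≤ t₀ := Real.sqrt_nonneg _
  set v₀ : ℝ := pM * c₂ * (2 * d / Lmin) ^ d * 2 ^ d * a' with hv₀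
  have hv₀0 : 0 < v₀ := by positivity
  set M : ℝ := 2 + 2 * v₀ * (4 * (t₀ ^ 2 * 2 ^ d * a * b) + 8 * Λ) with hM
  have hM2 : 2 ≤ M := by
    have : 0 ≤ 2 * v₀ * (4 * (t₀ ^ 2 * 2 ^ d * a * b) + 8 * Λ) := by positivity
    linarith
  refine ⟨M, by linarith, ?_⟩
  rw [← eventually_atTop]
  filter_upwards [hb.bound, hlog.eventually_ge_atTop 1, eventually_mul_log_le hr hK.2 4,
    eventually_mul_log_le hr hK.2 (1 / a), eventually_mul_log_le hr hK.2 (1 / a'),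
    eventually_mul_log_le hr hK.2 (8 / (α * a)), eventually_mul_le_natCast hK.1 one_pos,
    eventually_mul_le_natCast hK.1 ha0, eventually_mul_le_natCast hK.1 ha0',
    eventually_mul_le_natCast hK.1 (show 0 < a * (2 / η) ^ d by positivity),
    eventually_mul_le_natCast hK.1 (show 0 < a' * (2 / η) ^ d by positivity),
    tendsto_natCast_atTop_atTop.eventually_ge_atTop ((3 + C + 2 * d) / (δ / 2)),
    eventually_gt_atTop 0]
    with n hKb hL1 hK4 hKa hKa' hKα hKn hna hna' hnη hnη' hnδ hn0
  intro X _ _ _ μ p f₀ Ω _ P _ x ε hp hball hX _ hS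
  set L : ℝ := Real.log n with hL
  have hL0 : 0 < L := by linarith
  have hn : (0 : ℝ) < n := by exact_mod_cast hn0
  have hKR : (0 : ℝ) < K n := by linarith
  rw [Real.norm_of_nonneg (by positivity), Real.norm_of_nonneg (by positivity)] at hKb
  obtain ⟨J, hJ1, hJ2, hJη⟩ := exists_gridSide ha0 hKR hη0 (by omega : d ≠ 0) hna (by linarith)
  obtain ⟨J', hJ1', hJ2', hJη'⟩ :=
    exists_gridSide ha0' hKR hη0 (by omega : d ≠ 0) hna' (by linarith)
  have hside : ∀ {a : ℝ} {j : ℕ}, 0 < a → 1 / a * L ≤ K n → a * K n * 2 ^ (j * d) ≤ n →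
      2 ^ (j * d) ≤ n := fun {a j} ha hKa hj => by
    have h1 : 1 ≤ a * K n := by
      rw [one_div, inv_mul_le_iff₀ ha] at hKa
      linarith
    have h2 : (2 : ℝ) ^ (j * d) ≤ n := (le_mul_of_one_le_left (by positivity) h1).trans hj
    exact_mod_cast h2
  have hJn := hside ha0 hKa hJ1
  have hJn' := hside ha0' hKa' hJ1'
  have hrad : ∀ {y : ℝ}, y < η → (4 * Lmax)⁻¹ * y < r₀ := fun {y} hy => by
    rw [inv_mul_lt_iff₀ (by positivity)]
    exact hy.trans_le (min_le_left _ _)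
  have hrad2 : ∀ {y : ℝ}, y < η → 2 * (2 * d / Lmin * y) < r₀ := fun {y} hy => by
    have h1 := hy.trans_le (min_le_right _ _)
    rw [lt_div_iff₀ (by positivity)] at h1
    have h2 : 2 * (2 * d / Lmin * y) = y * (4 * d) / Lmin := by ring
    rw [h2, div_lt_iff₀ hLmin]
    exact h1
  have h2J : (0 : ℝ) < 2 ^ (J * d) := by positivity
  have h2J' : (0 : ℝ) < 2 ^ (J' * d) := by positivity
  set Q : ℝ := L ^ (3 / 2 + r) with hQ
  set R : ℝ := L ^ (1 + 2 * r) with hR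
  have hQ0 : 0 < Q := by positivity
  have hR1 : 1 ≤ R := Real.one_le_rpow hL1 (by positivity)
  have hQR : Q ^ 2 = R * L * L := by
    rw [hQ, hR, sq, ← Real.rpow_add hL0, mul_assoc, ← sq, ← Real.rpow_natCast L 2,
      ← Real.rpow_add hL0]
    congr 1
    push_cast
    ring
  have hw1 : a * K n ≤ n * ((2 : ℝ) ^ (J * d))⁻¹ := by
    rwa [← div_eq_mul_inv, le_div_iff₀ h2J]
  have hw2 : n * ((2 : ℝ) ^ (J * d))⁻¹ ≤ a * K n * 2 ^ d := by
    rwa [← div_eq_mul_inv, div_le_iff₀ h2J]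
  have hw1' : a' * K n ≤ n * ((2 : ℝ) ^ (J' * d))⁻¹ := by
    rwa [← div_eq_mul_inv, le_div_iff₀ h2J']
  have hw2' : n * ((2 : ℝ) ^ (J' * d))⁻¹ ≤ a' * K n * 2 ^ d := by
    rwa [← div_eq_mul_inv, div_le_iff₀ h2J']
  have hinvpow : ∀ j : ℕ, ((2 : ℝ) ^ j)⁻¹ ^ d = ((2 : ℝ) ^ (j * d))⁻¹ := fun j => by
    rw [inv_pow, pow_mul]
  have hup : n * (pM * (c₂ * (2 * (2 * d / Lmin * ((2 : ℝ) ^ J)⁻¹)) ^ d)) ≤ K n / 4 := by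
    calc _ = β * (n * ((2 : ℝ) ^ (J * d))⁻¹) := by
          rw [hβ, ← hinvpow, show 2 * (2 * d / Lmin * ((2 : ℝ) ^ J)⁻¹)
            = 4 * d / Lmin * ((2 : ℝ) ^ J)⁻¹ by ring, mul_pow]
          ring
      _ ≤ β * (a * K n * 2 ^ d) := by gcongr
      _ = K n / 4 := by rw [ha]; field_simp
  have hlow : 8 * L ≤ n * (pmin * c₁ * (4 * Lmax)⁻¹ ^ d * ((2 : ℝ) ^ (J * d))⁻¹) := by
    rw [div_mul_eq_mul_div, div_le_iff₀ (by positivity)] at hKα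
    calc 8 * L ≤ α * (a * K n) := by linarith
      _ ≤ α * (n * ((2 : ℝ) ^ (J * d))⁻¹) := by gcongr
      _ = _ := by rw [hα]; ring
  have hlow' : 4 * K n ≤ n * (pmin * c₁ * (4 * Lmax)⁻¹ ^ d * ((2 : ℝ) ^ (J' * d))⁻¹) := by
    calc 4 * (K n : ℝ) = α * (a' * K n) := by rw [ha']; field_simp
      _ ≤ α * (n * ((2 : ℝ) ^ (J' * d))⁻¹) := by gcongr
      _ = _ := by rw [hα]; ring
  have hτ' : 4 * σ ^ 2 * L ≤ (2 * σ * Q) ^ 2 := by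
    have h1 : (2 * σ * Q) ^ 2 = 4 * σ ^ 2 * (R * L * L) := by rw [← hQR]; ring
    rw [h1]
    have h2 : 1 ≤ R * L := one_le_mul_of_one_le_of_one_le hR1 hL1
    exact mul_le_mul_of_nonneg_left (le_mul_of_one_le_left hL0.le h2) (by positivity)
  have hJL := natCast_add_one_le_two_mul_log hd hL1 hJn
  have ht' : 4 * (c * (K n * (3 * 2 ^ d * (J + 1)))) * L ≤ (T * Q) ^ 2 := by
    have h1 : (T * Q) ^ 2 = 24 * c * b * 2 ^ d * (R * L * L) := by
      rw [mul_pow, hQR, hT, Real.sq_sqrt (by positivity)]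
    calc 4 * (c * (K n * (3 * 2 ^ d * (J + 1)))) * L
        ≤ 4 * (c * ((b * R) * (3 * 2 ^ d * (2 * L)))) * L := by gcongr
      _ = (T * Q) ^ 2 := by rw [h1]; ring
  have hlam : 2 * (2 * σ * Q) + 2 * (T * Q) ≤ Λ * Q := le_of_eq (by rw [hΛ]; ring)
  have hp' : IsBoundedDensity μ p pmin pM :=
    ⟨hp.measurable, hp.lintegral_eq_one, hp.lower, fun q => (hp.upper q).trans_le (le_max_left _ _)⟩
  have hmain := measure_predictionError_gt_le (f₀ := f₀) hd hp' hball hX hpmin hpM0 hc₂ hLmin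
    hLmax hC hσ hn0 hS (K := K n) (by rw [one_mul] at hKn; exact_mod_cast hKn) hK4
    (by exact_mod_cast hKR) hJn hJn' (hrad hJη) (hrad hJη') (hrad2 hJη)
    (by
      have h1 := hrad2 hJη'
      have h2 : 0 ≤ 2 * d / Lmin * ((2 : ℝ) ^ J')⁻¹ := by positivity
      linarith)
    hup hlow hlow' (by positivity) (by positivity) ht₀0 hτ' ht' hlam
  rw [if_pos hL1]
  refine le_trans (measure_mono fun ω hω => ?_) (hmain.trans (ENNReal.ofReal_le_ofReal ?_))
  · rw [Set.mem_ofPred_eq] at hω ⊢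
    refine lt_of_le_of_lt ?_ hω
    set A := approxError (densityLaw μ p) f₀ (fun i => x i ω) (K n)
    set V := graphTV (knnGraph (fun i => x i ω) (K n)) (fun i => f₀ (x i ω)) with hV
    have hV0 : 0 ≤ V := graphTV_nonneg _ _
    rw [mul_add (ENNReal.ofReal M), add_comm, ← ENNReal.ofReal_mul (by linarith)]
    refine add_le_add (ENNReal.ofReal_le_ofReal ?_) (mul_le_mul' ?_ le_rfl)
    · have h1 : 2 * (pM * (c₂ * (2 * d / Lmin * ((2 : ℝ) ^ J')⁻¹) ^ d)) / K n ≤ 2 * v₀ / n := by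
        rw [div_le_div_iff₀ hKR hn]
        calc _ = 2 * (pM * c₂ * (2 * d / Lmin) ^ d) * (n * ((2 : ℝ) ^ (J' * d))⁻¹) := by
              rw [mul_pow, hinvpow]; ring
          _ ≤ 2 * (pM * c₂ * (2 * d / Lmin) ^ d) * (a' * K n * 2 ^ d) := by gcongr
          _ = 2 * v₀ * K n := by rw [hv₀]; ring
      have h2 : t₀ ^ 2 * n * ((2 : ℝ) ^ (J * d))⁻¹ ≤ t₀ ^ 2 * 2 ^ d * a * b * R := by
        calc _ = t₀ ^ 2 * (n * ((2 : ℝ) ^ (J * d))⁻¹) := by ring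
          _ ≤ t₀ ^ 2 * (a * K n * 2 ^ d) := mul_le_mul_of_nonneg_left hw2 (by positivity)
          _ ≤ t₀ ^ 2 * (a * (b * R) * 2 ^ d) := by gcongr
          _ = _ := by ring
      exact prediction_rate_le hv₀0.le (by positivity) hΛ0.le hQ0.le (by positivity) hV0 hn h1 h2
        (by positivity)
    · rw [← ENNReal.ofReal_ofNat]
      exact ENNReal.ofReal_le_ofReal hM2
  · have h1 := two_mul_exp_neg_sq_div_le hc0 hδ
    have h2 : (3 + C + 2 * d) / n ≤ δ / 2 := by
      rw [div_le_iff₀ (by positivity)] at hnδ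
      rw [div_le_iff₀ hn]
      linarith
    linarith
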